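/- A stationary Bratteli diagram $B$ has a root, the same finite vertex set $V$ on every level $1,2,\dots$, and the same incidence matrix $F$ between all consecutive levels $\ge 1$ ($F_{wv}$ is the number of edges from $v$ on a level to $w$ on the next one); there is at least one edge from the root to each vertex of level $1$, and every vertex has an incoming and an outgoing edge at every step. Let $A=F^T$, let $X_B$ be the space of infinite paths from the root with its usual topology, and let $\mathcal R$ be the tail equivalence relation on $X_B$ (two paths are equivalent if they agree from some level on); assume that $\mathcal R$ is aperiodic, i.e. has no finite classes. A cylinder set is the set of all infinite paths with a given initial segment; it ends in the last vertex of that segment. A class of vertices is an equivalence class for mutual accessibility. Let $\mu$ be a non-atomic ergodic $\mathcal R$-invariant Borel measure on $X_B$ with $\mu(X_B)=\infty$, defined by a class $\alpha$ of vertices, an eigenvalue $\lambda$ of $A$ and a reduced vector $(x_i)$, in the following sense. The measure $\mu$ is carried by the set of paths that eventually pass only through vertices of $\alpha$. Let $V_f$ be the set of vertices $i$ that have access to $\alpha$ and are such that all cylinder sets ending in $i$ have finite measure, and let $A_f$ be the restriction of $A$ to $V_f\times V_f$. Then $x=(x_i)_{i\in V_f}$ is a vector with positive entries and $A_f x=\lambda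 x$, and $\mu(C)=x_i/\lambda^{N-1}$ for every cylinder set $C$ that ends in a vertex $i\in\alpha$ on level $N\ge 1$. (As $\mu$ is infinite, $\alpha$ is then a non-distinguished class: no non-negative eigenvector of $A$ for $\lambda$ is positive on $\alpha$.) Let $H$ be the additive subgroup of $\mathbb R$ generated by $\{x_i : i\in V_f\}$, and let $$S(\mu)=\{\mu(U) : U\subseteq X_B \text{ clopen},\ \mu(U)<\infty\}.$$ Then $$S(\mu)=\Bigl(\bigcup_{N=0}^{\infty}\frac1{\lambda^N}H\Bigr)\cap[0,\infty),$$ and $S(\mu)$ is group-like, that is, $S(\mu)$ is a countable, dense and unbounded subset of $[0,\infty)$ and for every $\gamma\in S(\mu)$ there is an additive subgroup $G$ of $\mathbb R$ with $S(\mu)\cap[0,\gamma]=G\cap[0,\gamma]$. -/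

import Mathlib

open MeasureTheory

/-- A stationary Bratteli diagram. Every level `1, 2, 3, …` carries the same finite vertex set `V`;
`F w v` is the number of edges from the vertex `v` of a level to the vertex `w` of the next level
(the incidence matrix), and `hat v` is the number of edges from the root to the vertex `v` of
level `1`. Every vertex has at least one incoming and at least one outgoing edge. -/
structure StationaryBratteli (V : Type*) where
  F : Matrix V V ℕ
  hat : V → ℕ
  hat_pos : ∀ v, 0 < hat v
  exists_in : ∀ w, ∃ v, 0 < F w v
  exists_out : ∀ v, ∃ w, 0 < F w v

namespace StationaryBratteli

variable {V : Type*} (B : StationaryBratteli V)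

/-- Edges from the root to level `1`. -/
abbrev HatEdge : Type _ := Σ v : V, Fin (B.hat v)

/-- Edges between two consecutive levels: `⟨(v, w), i⟩` is the `i`-th edge from `v` to `w`. -/
abbrev Edge : Type _ := Σ p : V × V, Fin (B.F p.2 p.1)

/-- The space `X_B` of infinite paths starting at the root: an edge from the root followed by
edges numbered `0, 1, 2, …`, edge `n` going from level `n + 1` to level `n + 2`. -/
def PathSpace : Type _ :=
  {p : B.HatEdge × (ℕ → B.Edge) //
    (p.2 0).1.1 = p.1.1 ∧ ∀ n, (p.2 (n + 1)).1.1 = (p.2 n).1.2}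

/-- The product topology, all edge sets being discrete. -/
instance : TopologicalSpace B.PathSpace :=
  inferInstanceAs (TopologicalSpace {p : B.HatEdge × (ℕ → B.Edge) //
    (p.2 0).1.1 = p.1.1 ∧ ∀ n, (p.2 (n + 1)).1.1 = (p.2 n).1.2})

instance : MeasurableSpace B.PathSpace := borel B.PathSpace

instance : BorelSpace B.PathSpace := ⟨rfl⟩

variable {B}

/-- The vertex of level `n + 1` through which a path passes. -/
def PathSpace.vertex (p : B.PathSpace) (n : ℕ) : V := (p.1.2 n).1.1

/-- The cylinder set of all paths that agree with `p` from the root down to level `n + 1`;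
it ends in the vertex `p.vertex n`. Every finite path extends to an infinite one, so that all
cylinder sets are of this form. -/
def PathSpace.cylinder (p : B.PathSpace) (n : ℕ) : Set B.PathSpace :=
  {q | q.1.1 = p.1.1 ∧ ∀ k < n, q.1.2 k = p.1.2 k}

/-- The tail (cofinal) equivalence relation: two paths agree from some level on. -/
def TailEquiv (p q : B.PathSpace) : Prop := ∃ N, ∀ n, N ≤ n → p.1.2 n = q.1.2 n

variable (B)

/-- The tail equivalence relation is aperiodic: it has no finite classes. -/
def Aperiodic : Prop := ∀ p : B.PathSpace, {q : B.PathSpace | TailEquiv p q}.Infinite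

/-- There is a (possibly trivial) descending finite path from `v` to `w`. -/
def Accesses (v w : V) : Prop := Relation.ReflTransGen (fun a b => 0 < B.F b a) v w

/-- `α` is a class of vertices: an equivalence class of mutually accessible vertices. -/
def IsVertexClass (α : Set V) : Prop := ∃ v, α = {w | B.Accesses v w ∧ B.Accesses w v}

/-- The set `X_α` of paths that eventually pass only through vertices of `α`. -/
def eventuallyIn (α : Set V) : Set B.PathSpace := {p | ∃ N, ∀ n, N ≤ n → p.vertex n ∈ α}

variable {B}

/-- Invariance of a measure under the tail equivalence relation: every injective Borel map defined
on a Borel set and moving each point within its tail class preserves the measure. -/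
def TailInvariant (μ : Measure B.PathSpace) : Prop :=
  ∀ f : B.PathSpace → B.PathSpace, Measurable f → ∀ A : Set B.PathSpace, MeasurableSet A →
    Set.InjOn f A → (∀ p ∈ A, TailEquiv p (f p)) → μ (f '' A) = μ A

/-- Ergodicity: every Borel set that is a union of tail classes is null or conull. -/
def TailErgodic (μ : Measure B.PathSpace) : Prop :=
  ∀ A : Set B.PathSpace, MeasurableSet A → (∀ p ∈ A, ∀ q, TailEquiv p q → q ∈ A) →
    μ A = 0 ∨ μ Aᶜ = 0

/-- The vertices of the subdiagram `B_f`: those that have access to the class `α` and for which all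
cylinder sets ending in them have finite measure. -/
def finiteVertices (μ : Measure B.PathSpace) (α : Set V) : Set V :=
  {v | (∃ w ∈ α, B.Accesses v w) ∧
    ∀ (p : B.PathSpace) (n : ℕ), p.vertex n = v → μ (p.cylinder n) < ⊤}

/-- The measure `μ` is defined by the class `α`, the eigenvalue `lam` and the reduced vector `x`.
The reduced vector (extended by zero to all of `V`) is a positive eigenvector, for the eigenvalue
`lam`, of the matrix `A_f` transposed to the incidence matrix of `B_f`; the measure is carried by
the paths that eventually stay in `α`, and there it is given by the usual eigenvector formula: a
cylinder set that ends in a vertex `v` of `α` on level `n + 1` has measure `x v / lam ^ n`. -/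
structure IsDefinedBy [Fintype V] (μ : Measure B.PathSpace) (α : Set V) (lam : ℝ) (x : V → ℝ) :
    Prop where
  isVertexClass : B.IsVertexClass α
  carried : μ (B.eventuallyIn α)ᶜ = 0
  measure_cylinder : ∀ (p : B.PathSpace) (n : ℕ), p.vertex n ∈ α →
    μ (p.cylinder n) = ENNReal.ofReal (x (p.vertex n) / lam ^ n)
  pos : ∀ v ∈ finiteVertices μ α, 0 < x v
  eq_zero : ∀ v, v ∉ finiteVertices μ α → x v = 0
  eigen : ∀ v ∈ finiteVertices μ α, ∑ w, (B.F w v : ℝ) * x w = lam * x v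

end StationaryBratteli

/-- The clopen values set `S(μ)`: the finite values of `μ` on clopen sets. -/
def clopenValues {X : Type*} [TopologicalSpace X] [MeasurableSpace X] (μ : Measure X) : Set ℝ :=
  {r | ∃ U : Set X, IsClopen U ∧ μ U < ⊤ ∧ r = (μ U).toReal}

/-- Group-like sets: dense countable unbounded subsets `D` of `[0, ∞)` such that for every
`γ ∈ D` there is an additive subgroup `G` of `ℝ` with `D ∩ [0, γ] = G ∩ [0, γ]`. -/
def IsGroupLike (D : Set ℝ) : Prop :=
  D ⊆ Set.Ici 0 ∧ Set.Ici 0 ⊆ closure D ∧ D.Countable ∧ ¬ BddAbove D ∧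
    ∀ γ ∈ D, ∃ G : AddSubgroup ℝ, D ∩ Set.Icc 0 γ = (G : Set ℝ) ∩ Set.Icc 0 γ

/-! Index `n` stands for level `n + 1`. Let `G` be the union of the groups `lam ^ (-N) H`.

Upper bound. A clopen set is a finite disjoint union of cylinder sets, so it suffices that each
cylinder set of finite measure ending in `v` has measure `x v / lam ^ n`. This is given only for `v
∈ α`. For other `v` the measure is the increasing limit, over `K`, of the mass that sits in `α`
after `K` further edges. The limits solve the same eigenvector equation as `x` and agree with it on
`α`; since `lam` does not occur as an eigenvalue outside `α` (`IsDefinedBy.eq_zero_of_eigen`), they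
equal `x` (`IsDefinedBy.measure_cyl`).

Lower bound. For `t > 0` in `G`, `lam ^ n * t` is an integral combination of the `x v`, but
coefficients may be negative or exceed the number of available paths. Three facts repair this.
Outside `α` the entries of `x` are rational combinations of those on `α`, again because `lam` is not
an eigenvalue there. So coefficients outside `α` can be taken in a fixed range `[0, D]`
(`IsDefinedBy.exists_reduced_combination`), and aperiodicity supplies that many paths. Ergodicity
gives a power of the matrix of `α` a positive row, so an integral vector pairing positively with `x`
becomes nonnegative under high powers (`IsDefinedBy.eventually_mulVec_nonneg`): prolonging paths
turns coefficients into path counts. Infinite total measure leaves room for these paths off the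
clopen set already chosen (`IsDefinedBy.exists_family_of_class_combination`).

Non-atomicity gives `lam > 1`. This makes the part of `lam ^ n * t` carried by `α` positive for
large `n`, and makes `G` dense; group-likeness then follows from the equality with `G ∩ [0, ∞)`. -/

namespace StationaryBratteli

universe u

variable {V : Type u} (B : StationaryBratteli V)

/-! ### Finite paths, cylinder sets and compactness of the path space. -/

/-- The finite paths from the root to the vertex `w` of level `n + 1`. -/
def FinPath : ℕ → V → Type u
  | 0 => fun w => ULift.{u} (Fin (B.hat w))
  | n + 1 => fun w => Σ v : V, FinPath n v × Fin (B.F w v)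

instance FinPath.instFintype [Fintype V] : ∀ (n : ℕ) (w : V), Fintype (B.FinPath n w)
  | 0, w => inferInstanceAs (Fintype (ULift.{u} (Fin (B.hat w))))
  | n + 1, w =>
    have := FinPath.instFintype n
    inferInstanceAs (Fintype (Σ v : V, B.FinPath n v × Fin (B.F w v)))

variable {B}

/-- The finite path `c` prolonged by the `i`-th edge from its end vertex to `w`. -/
def FinPath.snoc {n : ℕ} {v : V} (c : B.FinPath n v) (w : V) (i : Fin (B.F w v)) :
    B.FinPath (n + 1) w := ⟨v, c, i⟩

/-- The set of infinite paths with initial segment `c`. -/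
def FinPath.cyl : ∀ {n : ℕ} {w : V}, B.FinPath n w → Set B.PathSpace
  | 0, w, i => {p | p.1.1 = ⟨w, i.down⟩}
  | n + 1, w, c => {p | p ∈ FinPath.cyl (n := n) c.2.1 ∧ p.1.2 n = ⟨(c.1, w), c.2.2⟩}

theorem PathSpace.vertex_succ (p : B.PathSpace) (n : ℕ) : p.vertex (n + 1) = (p.1.2 n).1.2 :=
  p.2.2 n

theorem PathSpace.F_pos (p : B.PathSpace) (n : ℕ) : 0 < B.F (p.vertex (n + 1)) (p.vertex n) := by
  rw [p.vertex_succ]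
  exact Fin.pos (p.1.2 n).2

theorem FinPath.vertex_eq : ∀ {n : ℕ} {w : V} (c : B.FinPath n w) {p : B.PathSpace},
    p ∈ c.cyl → p.vertex n = w
  | 0, w, c, p, h => by
    have h' : p.1.1 = ⟨w, c.down⟩ := h
    rw [PathSpace.vertex, p.2.1, h']
  | n + 1, w, c, p, h => by
    have h' : p.1.2 n = ⟨(c.1, w), c.2.2⟩ := h.2
    rw [p.vertex_succ, h']

theorem FinPath.exists_mem_cyl (p : B.PathSpace) : ∀ n : ℕ, ∃ c : B.FinPath n (p.vertex n), p ∈ c.cyl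
  | 0 => by
    have h : p.vertex 0 = p.1.1.1 := p.2.1
    rw [h]
    exact ⟨⟨p.1.1.2⟩, rfl⟩
  | n + 1 => by
    obtain ⟨c, hc⟩ := FinPath.exists_mem_cyl p n
    rw [p.vertex_succ]
    exact ⟨FinPath.snoc c _ (p.1.2 n).2, hc, rfl⟩

theorem FinPath.eq_of_mem : ∀ {n : ℕ} {w : V} (c d : B.FinPath n w) {p : B.PathSpace},
    p ∈ c.cyl → p ∈ d.cyl → c = d
  | 0, w, c, d, p, hc, hd => by
    have h : (⟨w, c.down⟩ : B.HatEdge) = ⟨w, d.down⟩ := Eq.trans (Eq.symm hc) hd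
    simp only [Sigma.mk.injEq, heq_eq_eq, true_and] at h
    exact ULift.ext _ _ h
  | n + 1, w, ⟨v, c, i⟩, ⟨v', d, j⟩, p, hc, hd => by
    have h : (⟨(v, w), i⟩ : B.Edge) = ⟨(v', w), j⟩ := hc.2.symm.trans hd.2
    obtain rfl : v = v' := by
      have := congrArg (fun e : B.Edge => e.1.1) h
      exact this
    simp only [Sigma.mk.injEq, heq_eq_eq, true_and] at h
    have := FinPath.eq_of_mem c d hc.1 hd.1
    subst this
    subst h
    rfl

theorem FinPath.mem_cyl_iff : ∀ {n : ℕ} {w : V} (c : B.FinPath n w) {p q : B.PathSpace},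
    p ∈ c.cyl → (q ∈ c.cyl ↔ q.1.1 = p.1.1 ∧ ∀ k < n, q.1.2 k = p.1.2 k)
  | 0, w, c, p, q, hp => by
    have hp' : p.1.1 = ⟨w, c.down⟩ := hp
    simp [FinPath.cyl, hp']
  | n + 1, w, ⟨v, c, i⟩, p, q, hp => by
    have ih := FinPath.mem_cyl_iff c (q := q) hp.1
    have h2 : p.1.2 n = ⟨(v, w), i⟩ := hp.2
    change (q ∈ c.cyl ∧ q.1.2 n = ⟨(v, w), i⟩) ↔ _
    rw [ih, ← h2]
    constructor
    · rintro ⟨⟨h1, h3⟩, h4⟩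
      refine ⟨h1, fun k hk => ?_⟩
      rcases Nat.lt_succ_iff_lt_or_eq.1 hk with h | rfl
      · exact h3 k h
      · exact h4
    · rintro ⟨h1, h3⟩
      exact ⟨⟨h1, fun k hk => h3 k (by omega)⟩, h3 n (by omega)⟩

theorem FinPath.cyl_eq_cylinder {n : ℕ} {w : V} (c : B.FinPath n w) {p : B.PathSpace}
    (hp : p ∈ c.cyl) : c.cyl = p.cylinder n :=
  Set.ext fun _ => FinPath.mem_cyl_iff c hp

/-- Some edge leaving the vertex `v`. -/
noncomputable def outEdge (B : StationaryBratteli V) (v : V) : B.Edge :=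
  ⟨(v, (B.exists_out v).choose), ⟨0, (B.exists_out v).choose_spec⟩⟩

/-- Some infinite path of edges starting in the vertex `v`. -/
noncomputable def outPath (B : StationaryBratteli V) (v : V) : ℕ → B.Edge
  | 0 => B.outEdge v
  | n + 1 => B.outEdge (outPath B v n).1.2

/-- Every vertex starts an infinite path of edges, so a truncated path can be prolonged. -/
theorem PathSpace.exists_prolong (p : B.PathSpace) (n : ℕ) (w : V) (i : Fin (B.F w (p.vertex n))) :
    ∃ q : B.PathSpace, q.1.1 = p.1.1 ∧ (∀ k < n, q.1.2 k = p.1.2 k) ∧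
      q.1.2 n = ⟨(p.vertex n, w), i⟩ := by
  classical
  let e : ℕ → B.Edge := fun k => if k < n then p.1.2 k else
    if k = n then ⟨(p.vertex n, w), i⟩ else B.outPath w (k - (n + 1))
  have h1 : (e 0).1.1 = p.1.1.1 := by
    rcases Nat.eq_zero_or_pos n with rfl | h
    · simp only [e, lt_irrefl, if_false, if_true]
      exact p.2.1
    · simp only [e, h, if_true]
      exact p.2.1
  have h2 : ∀ k, (e (k + 1)).1.1 = (e k).1.2 := by
    intro k
    rcases lt_trichotomy (k + 1) n with h | h | h
    · simp only [e, h, show k < n by omega, if_true]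
      exact p.2.2 k
    · subst h
      simp only [e, lt_irrefl, if_false, if_true, Nat.lt_succ_self]
      exact p.2.2 k
    · rcases eq_or_ne k n with rfl | h'
      · simp only [e, lt_irrefl, if_false, if_true, show ¬ (k + 1 < k) by omega,
          show ¬ (k + 1 = k) by omega, Nat.sub_self]
        rfl
      · obtain ⟨m, rfl⟩ : ∃ m, k = n + 1 + m := ⟨k - (n + 1), by omega⟩
        simp only [e, if_false, show ¬ (n + 1 + m + 1 < n) by omega,
          show ¬ (n + 1 + m + 1 = n) by omega, show ¬ (n + 1 + m < n) by omega,
          show ¬ (n + 1 + m = n) by omega, show n + 1 + m + 1 - (n + 1) = m + 1 by omega,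
          show n + 1 + m - (n + 1) = m by omega]
        rfl
  refine ⟨⟨(p.1.1, e), h1, h2⟩, rfl, fun k hk => ?_, ?_⟩
  · simp only [e, hk, if_true]
  · simp only [e, lt_irrefl, if_false, if_true]

theorem exists_path_of_hat (v : V) (i : Fin (B.hat v)) : ∃ p : B.PathSpace, p.1.1 = ⟨v, i⟩ :=
  ⟨⟨(⟨v, i⟩, B.outPath v), rfl, fun _ => rfl⟩, rfl⟩

theorem FinPath.cyl_nonempty : ∀ {n : ℕ} {w : V} (c : B.FinPath n w), c.cyl.Nonempty
  | 0, w, c => exists_path_of_hat w c.down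
  | n + 1, w, ⟨v, c, i⟩ => by
    obtain ⟨p, hp⟩ := FinPath.cyl_nonempty c
    obtain rfl := FinPath.vertex_eq c hp
    obtain ⟨q, h1, h2, h3⟩ := p.exists_prolong n w i
    exact ⟨q, (FinPath.mem_cyl_iff c hp).2 ⟨h1, h2⟩, h3⟩

theorem FinPath.nonempty : ∀ (n : ℕ) (w : V), Nonempty (B.FinPath n w)
  | 0, w => ⟨⟨⟨0, B.hat_pos w⟩⟩⟩
  | n + 1, w => by
    obtain ⟨v, hv⟩ := B.exists_in w
    obtain ⟨c⟩ := FinPath.nonempty n v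
    exact ⟨c.snoc w ⟨0, hv⟩⟩

theorem PathSpace.continuous_hat : Continuous fun p : B.PathSpace => p.1.1 :=
  continuous_fst.comp continuous_subtype_val

theorem PathSpace.continuous_edge (n : ℕ) : Continuous fun p : B.PathSpace => p.1.2 n :=
  (continuous_apply n).comp (continuous_snd.comp continuous_subtype_val)

theorem FinPath.isClopen_cyl : ∀ {n : ℕ} {w : V} (c : B.FinPath n w), IsClopen c.cyl
  | 0, w, c => (isClopen_discrete {(⟨w, c.down⟩ : B.HatEdge)}).preimage PathSpace.continuous_hat
  | n + 1, w, ⟨v, c, i⟩ => (FinPath.isClopen_cyl c).inter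
      ((isClopen_discrete {(⟨(v, w), i⟩ : B.Edge)}).preimage (PathSpace.continuous_edge n))

theorem isClopen_vertex_mem (n : ℕ) (s : Set V) : IsClopen {p : B.PathSpace | p.vertex n ∈ s} :=
  (isClopen_discrete {e : B.Edge | e.1.1 ∈ s}).preimage (PathSpace.continuous_edge n)

theorem isOpen_iff_cyl {U : Set B.PathSpace} (hU : IsOpen U) {p : B.PathSpace} (hp : p ∈ U) :
    ∃ n, p.cylinder n ⊆ U := by
  obtain ⟨W, hW, rfl⟩ := isOpen_induced_iff.1 hU
  obtain ⟨s, t, hs, ht, hps, hpt, hst⟩ := isOpen_prod_iff.1 hW p.1.1 p.1.2 hp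
  obtain ⟨I, f, hf, hI⟩ := isOpen_pi_iff.1 ht _ hpt
  obtain ⟨n, hn⟩ := I.exists_nat_subset_range
  refine ⟨n, fun q hq => hst ⟨?_, hI fun k hk => ?_⟩⟩
  · rw [hq.1]; exact hps
  · rw [hq.2 k (Finset.mem_range.1 (hn hk))]; exact (hf k hk).2

theorem PathSpace.cylinder_anti (p : B.PathSpace) {m n : ℕ} (h : m ≤ n) :
    p.cylinder n ⊆ p.cylinder m := fun _ hq => ⟨hq.1, fun k hk => hq.2 k (hk.trans_le h)⟩

theorem PathSpace.isClopen_cylinder (p : B.PathSpace) (n : ℕ) : IsClopen (p.cylinder n) := by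
  obtain ⟨c, hc⟩ := FinPath.exists_mem_cyl p n
  rw [← c.cyl_eq_cylinder hc]
  exact c.isClopen_cyl

/-- The path space is a closed subset of a product of finite discrete spaces. -/
instance [Finite V] : CompactSpace B.PathSpace := by
  have hc : IsClosed {p : B.HatEdge × (ℕ → B.Edge) |
      (p.2 0).1.1 = p.1.1 ∧ ∀ n, (p.2 (n + 1)).1.1 = (p.2 n).1.2} := by
    have h : ∀ (g : B.Edge → V) (n : ℕ) (s : Set V),
        IsClopen {p : B.HatEdge × (ℕ → B.Edge) | g (p.2 n) ∈ s} := fun g n s =>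
      (isClopen_discrete {e : B.Edge | g e ∈ s}).preimage ((continuous_apply n).comp continuous_snd)
    have h0 : ∀ s : Set V, IsClopen {p : B.HatEdge × (ℕ → B.Edge) | p.1.1 ∈ s} := fun s =>
      (isClopen_discrete {e : B.HatEdge | e.1 ∈ s}).preimage continuous_fst
    -- With `V` discrete, the matching conditions are equalities of continuous maps.
    let _ : TopologicalSpace V := ⊥
    have _ : DiscreteTopology V := ⟨rfl⟩
    have c1 : ∀ (g : B.Edge → V) (n : ℕ),
        Continuous fun p : B.HatEdge × (ℕ → B.Edge) => g (p.2 n) := fun g n =>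
      ⟨fun s _ => (h g n s).2⟩
    have c0 : Continuous fun p : B.HatEdge × (ℕ → B.Edge) => p.1.1 := ⟨fun s _ => (h0 s).2⟩
    refine IsClosed.inter (isClosed_eq (c1 (fun e => e.1.1) 0) c0) ?_
    change IsClosed {p : B.HatEdge × (ℕ → B.Edge) | ∀ n, (p.2 (n + 1)).1.1 = (p.2 n).1.2}
    rw [Set.ofPred_forall]
    exact isClosed_iInter fun n =>
      isClosed_eq (c1 (fun e => e.1.1) (n + 1)) (c1 (fun e => e.1.2) n)
  exact isCompact_iff_compactSpace.1 hc.isCompact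

/-- An increasing sequence of open sets which exhausts the path space is eventually everything. -/
theorem exists_eq_univ_of_monotone [Finite V] {O : ℕ → Set B.PathSpace} (hO : ∀ n, IsOpen (O n))
    (hmono : Monotone O) (h : ∀ p, ∃ n, p ∈ O n) : ∃ n, O n = Set.univ := by
  obtain ⟨n, hn⟩ := isCompact_univ.elim_directed_cover O hO
    (fun p _ => Set.mem_iUnion.2 (h p)) hmono.directed_le
  exact ⟨n, Set.univ_subset_iff.1 hn⟩

/-- The paths whose membership in `U` is decided by their segment down to index `n` form an open set
growing with `n`; as `U` is clopen these sets exhaust the space, and compactness gives one `n` for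
all paths. -/
theorem exists_level_of_isClopen [Finite V] {U : Set B.PathSpace} (hU : IsClopen U) :
    ∃ n, ∀ p : B.PathSpace, p.cylinder n ⊆ U ∨ p.cylinder n ⊆ Uᶜ := by
  have self_mem : ∀ (p : B.PathSpace) n, p ∈ p.cylinder n := fun p n => ⟨rfl, fun _ _ => rfl⟩
  have hcyl : ∀ {p q : B.PathSpace} {n}, q ∈ p.cylinder n → q.cylinder n = p.cylinder n := by
    intro p q n hq
    ext r
    exact ⟨fun hr => ⟨hr.1.trans hq.1, fun k hk => (hr.2 k hk).trans (hq.2 k hk)⟩,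
      fun hr => ⟨hr.1.trans hq.1.symm, fun k hk => (hr.2 k hk).trans (hq.2 k hk).symm⟩⟩
  have hO : ∃ n, {p : B.PathSpace | p.cylinder n ⊆ U ∨ p.cylinder n ⊆ Uᶜ} = Set.univ := by
    refine exists_eq_univ_of_monotone
      (O := fun n => {p : B.PathSpace | p.cylinder n ⊆ U ∨ p.cylinder n ⊆ Uᶜ}) ?_ ?_ ?_
    · intro n
      rw [isOpen_iff_mem_nhds]
      intro p hp
      refine Filter.mem_of_superset ((p.isClopen_cylinder n).2.mem_nhds (self_mem p n))
        fun q hq => ?_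
      change _ ∨ _
      rw [hcyl hq]
      exact hp
    · intro m n h p hp
      exact hp.imp (p.cylinder_anti h).trans (p.cylinder_anti h).trans
    · intro p
      by_cases hp : p ∈ U
      · obtain ⟨n, hn⟩ := isOpen_iff_cyl hU.2 hp
        exact ⟨n, Or.inl hn⟩
      · obtain ⟨n, hn⟩ := isOpen_iff_cyl hU.compl.2 hp
        exact ⟨n, Or.inr hn⟩
  exact hO.imp fun n hn p => Set.eq_univ_iff_forall.1 hn p

end StationaryBratteli

namespace StationaryBratteli

universe u

variable {V : Type u} {B : StationaryBratteli V}

/-! ### Clopen sets as finite families of finite paths. -/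

/-- A finite set of finite paths of length `n`, sorted by their end vertices. -/
abbrev PathFamily (B : StationaryBratteli V) (n : ℕ) : Type u := ∀ w : V, Finset (B.FinPath n w)

namespace PathFamily

/-- The infinite paths with an initial segment in the family. -/
def carrier {n : ℕ} (S : B.PathFamily n) : Set B.PathSpace := {p | ∃ w, ∃ c ∈ S w, p ∈ c.cyl}

theorem mem_carrier_iff {n : ℕ} (S : B.PathFamily n) {w : V} {c : B.FinPath n w}
    {p : B.PathSpace} (hp : p ∈ c.cyl) : p ∈ S.carrier ↔ c ∈ S w := by
  constructor
  · rintro ⟨w', c', hc', hp'⟩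
    obtain rfl : w = w' := (c.vertex_eq hp).symm.trans (c'.vertex_eq hp')
    rwa [FinPath.eq_of_mem c c' hp hp']
  · exact fun h => ⟨w, c, h, hp⟩

theorem carrier_mono {n : ℕ} {S T : B.PathFamily n} (h : ∀ w, S w ⊆ T w) :
    S.carrier ⊆ T.carrier := fun _ ⟨w, c, hc, hp⟩ => ⟨w, c, h w hc, hp⟩

section

variable [Fintype V]

/-- All one-edge prolongations of the paths of a family. -/
def extend {n : ℕ} (S : B.PathFamily n) : B.PathFamily (n + 1) := fun w =>
  (Finset.univ.sigma fun v => S v ×ˢ (Finset.univ : Finset (Fin (B.F w v))) :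
    Finset (Σ v : V, B.FinPath n v × Fin (B.F w v)))

/-- All prolongations by `j` edges of the paths of a family. -/
def extendBy {n : ℕ} (S : B.PathFamily n) : ∀ j : ℕ, B.PathFamily (n + j)
  | 0 => S
  | j + 1 => (S.extendBy j).extend

theorem card_extend {n : ℕ} (S : B.PathFamily n) (w : V) :
    (S.extend w).card = ∑ v, B.F w v * (S v).card := by
  refine (Finset.card_sigma _ _).trans ?_
  simp [Finset.card_product, mul_comm]

theorem carrier_extend {n : ℕ} (S : B.PathFamily n) : S.extend.carrier = S.carrier := by
  ext p
  constructor
  · rintro ⟨w, ⟨v, c, i⟩, hc, hp⟩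
    have hc' := (Finset.mem_product.1 (Finset.mem_sigma.1 hc).2).1
    exact ⟨v, c, hc', hp.1⟩
  · rintro ⟨v, c, hc, hp⟩
    obtain rfl := c.vertex_eq hp
    refine ⟨_, c.snoc _ (p.1.2 n).2, ?_, hp, rfl⟩
    exact Finset.mem_sigma.2 ⟨Finset.mem_univ _, Finset.mem_product.2 ⟨hc, Finset.mem_univ _⟩⟩

theorem carrier_extendBy {n : ℕ} (S : B.PathFamily n) :
    ∀ j, (S.extendBy j).carrier = S.carrier
  | 0 => rfl
  | j + 1 => (carrier_extend _).trans (carrier_extendBy S j)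

theorem carrier_eq_iUnion {n : ℕ} (S : B.PathFamily n) :
    S.carrier = ⋃ c ∈ Finset.univ.sigma S, c.2.cyl := by
  ext p
  simp [carrier, Sigma.exists]

theorem isClopen_carrier {n : ℕ} (S : B.PathFamily n) : IsClopen S.carrier := by
  rw [carrier_eq_iUnion]
  exact Set.Finite.isClopen_biUnion (Finset.finite_toSet _) fun c _ => c.2.isClopen_cyl

theorem measure_carrier {n : ℕ} (S : B.PathFamily n) (μ : Measure B.PathSpace) :
    μ S.carrier = ∑ w, ∑ c ∈ S w, μ c.cyl := by
  rw [carrier_eq_iUnion, measure_biUnion_finset, Finset.sum_sigma]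
  · rintro ⟨w, c⟩ _ ⟨w', c'⟩ _ hne
    refine Set.disjoint_left.2 fun p hp hp' => hne ?_
    obtain rfl : w = w' := (c.vertex_eq hp).symm.trans (c'.vertex_eq hp')
    obtain rfl := FinPath.eq_of_mem c c' hp hp'
    rfl
  · exact fun c _ => c.2.isClopen_cyl.2.measurableSet

theorem carrier_compl {n : ℕ} (S : B.PathFamily n) [∀ w, DecidableEq (B.FinPath n w)] :
    carrier (fun w => (S w)ᶜ) = S.carrierᶜ := by
  ext p
  obtain ⟨c, hc⟩ := FinPath.exists_mem_cyl p n
  rw [mem_carrier_iff _ hc, Set.mem_compl_iff, mem_carrier_iff _ hc, Finset.mem_compl]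

theorem exists_carrier_eq {U : Set B.PathSpace} (hU : IsClopen U) :
    ∃ (n : ℕ) (S : B.PathFamily n), U = S.carrier := by
  classical
  obtain ⟨n, hn⟩ := exists_level_of_isClopen hU
  refine ⟨n, fun w => Finset.univ.filter fun c => c.cyl ⊆ U, ?_⟩
  ext p
  obtain ⟨c, hc⟩ := FinPath.exists_mem_cyl p n
  rw [mem_carrier_iff _ hc, Finset.mem_filter, c.cyl_eq_cylinder hc]
  have hself : p ∈ p.cylinder n := ⟨rfl, fun _ _ => rfl⟩
  constructor
  · intro hp
    exact ⟨Finset.mem_univ _, (hn p).resolve_right fun h => h hself hp⟩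
  · exact fun h => h.2 hself

end

end PathFamily

theorem FinPath.measure_inter_eq_sum [Fintype V] {n : ℕ} {v : V} (c : B.FinPath n v)
    (μ : Measure B.PathSpace) {Y : Set B.PathSpace} (hY : MeasurableSet Y) :
    μ (c.cyl ∩ Y) = ∑ w, ∑ i, μ ((c.snoc w i).cyl ∩ Y) := by
  have h : c.cyl ∩ Y = ⋃ e ∈ (Finset.univ : Finset (Σ w, Fin (B.F w v))),
      ((c.snoc e.1 e.2).cyl ∩ Y) := by
    ext p
    simp only [Set.mem_inter_iff, Set.mem_iUnion, Finset.mem_univ, exists_prop, true_and,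
      Sigma.exists]
    constructor
    · rintro ⟨hp, hY⟩
      obtain rfl := c.vertex_eq hp
      exact ⟨_, (p.1.2 n).2, ⟨hp, rfl⟩, hY⟩
    · rintro ⟨w, i, hp, hY⟩
      exact ⟨hp.1, hY⟩
  rw [h, measure_biUnion_finset, ← Finset.univ_sigma_univ, Finset.sum_sigma]
  · rintro ⟨w, i⟩ _ ⟨w', i'⟩ _ hne
    refine Set.disjoint_left.2 fun p hp hp' => hne ?_
    have h : (⟨(v, w), i⟩ : B.Edge) = ⟨(v, w'), i'⟩ := hp.1.2.symm.trans hp'.1.2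
    obtain rfl : w = w' := congrArg (fun e : B.Edge => e.1.2) h
    simp only [Sigma.mk.injEq, heq_eq_eq, true_and] at h
    rw [h]
  · exact fun e _ => (c.snoc e.1 e.2).isClopen_cyl.2.measurableSet.inter hY

/-! ### Growth of the number of finite paths. -/

theorem card_finPath_le [Fintype V] {n : ℕ} {v w : V} (h : 0 < B.F w v) :
    Fintype.card (B.FinPath n v) ≤ Fintype.card (B.FinPath (n + 1) w) := by
  refine Fintype.card_le_of_injective (fun c => c.snoc w ⟨0, h⟩) fun c d hcd => ?_
  obtain ⟨p, hp⟩ := (c.snoc w ⟨0, h⟩).cyl_nonempty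
  have hcd' : c.snoc w ⟨0, h⟩ = d.snoc w ⟨0, h⟩ := hcd
  have hp' : p ∈ (d.snoc w ⟨0, h⟩).cyl := hcd' ▸ hp
  exact FinPath.eq_of_mem c d hp.1 hp'.1

/-- Take `D` paths in the infinite tail class of `p`. From a common index on they all coincide with
`p`, so they are told apart by their initial segments, which all end in the same vertex. -/
theorem exists_card_finPath_ge [Fintype V] (hB : B.Aperiodic) (p : B.PathSpace) (D : ℕ) :
    ∃ n, D ≤ Fintype.card (B.FinPath n (p.vertex n)) := by
  obtain ⟨T, hT, hcard⟩ := (hB p).exists_subset_card_eq D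
  choose! N hN using fun q (hq : q ∈ T) => hT hq
  let n := T.sup N
  refine ⟨n, ?_⟩
  have hag : ∀ q ∈ T, ∀ k, n ≤ k → p.1.2 k = q.1.2 k := fun q hq k hk =>
    hN q hq k ((Finset.le_sup (f := N) hq).trans hk)
  have hex : ∀ q ∈ T, ∃ c : B.FinPath n (p.vertex n), q ∈ c.cyl := by
    intro q hq
    have h : p.vertex n = q.vertex n := by rw [PathSpace.vertex, hag q hq n le_rfl]; rfl
    rw [h]
    exact FinPath.exists_mem_cyl q n
  have := FinPath.nonempty (B := B) n (p.vertex n)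
  choose! c hc using hex
  rw [← hcard, ← Finset.card_univ]
  refine Finset.card_le_card_of_injOn c (fun _ _ => Finset.mem_univ _) fun q hq r hr hqr => ?_
  have h1 := (FinPath.mem_cyl_iff (c r) (hc r hr)).1 (hqr ▸ hc q hq)
  refine Subtype.ext (Prod.ext h1.1 (funext fun k => ?_))
  rcases lt_or_ge k n with hk | hk
  · exact h1.2 k hk
  · rw [← hag q hq k hk, ← hag r hr k hk]

/-- In an aperiodic diagram the numbers of finite paths tend to infinity. -/
theorem exists_forall_card_finPath_ge [Fintype V] (hB : B.Aperiodic) (D : ℕ) :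
    ∃ M, ∀ n, M ≤ n → ∀ w, D ≤ Fintype.card (B.FinPath n w) := by
  have hmono : ∀ p : B.PathSpace, Monotone fun n => Fintype.card (B.FinPath n (p.vertex n)) :=
    fun p => monotone_nat_of_le_succ fun n => card_finPath_le (p.F_pos n)
  -- The counts increase along each path, so compactness makes the level uniform.
  have hO : ∃ n, {p : B.PathSpace | p.vertex n ∈ {v | D ≤ Fintype.card (B.FinPath n v)}} =
      Set.univ := by
    refine exists_eq_univ_of_monotone
      (O := fun n => {p : B.PathSpace | p.vertex n ∈ {v | D ≤ Fintype.card (B.FinPath n v)}})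
      (fun n => (isClopen_vertex_mem n _).2) (fun m n h p hp => ?_)
      (fun p => exists_card_finPath_ge hB p D)
    exact le_trans (show D ≤ _ from hp) (hmono p h)
  obtain ⟨M, hM⟩ := hO
  refine ⟨M, fun n hn w => ?_⟩
  obtain ⟨c⟩ := FinPath.nonempty (B := B) n w
  obtain ⟨p, hp⟩ := c.cyl_nonempty
  obtain rfl := c.vertex_eq hp
  exact le_trans (show D ≤ _ from Set.eq_univ_iff_forall.1 hM p) (hmono p hn)

end StationaryBratteli

/-! ### Asymptotics of powers of nonnegative matrices. -/

/-- Doeblin's argument: if a stochastic matrix has a power with a positive column `u`, and `w` is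
reached from `u`, then the column `w` of its powers is asymptotically constant and positive. -/
theorem Matrix.exists_pinched_columns {ι : Type*} [Fintype ι] [DecidableEq ι] {P : Matrix ι ι ℝ}
    (hP : ∀ v s, 0 ≤ P v s) (hrow : ∀ v, ∑ s, P v s = 1) {n₀ : ℕ} {u : ι}
    (hu : ∀ v, 0 < (P ^ n₀) v u) (hacc : ∀ w, ∃ j, 0 < (P ^ j) u w) (w : ι) :
    ∃ a₀ > 0, ∀ δ > 0, ∃ M a, a₀ ≤ a ∧ ∀ m, M ≤ m → ∀ v, a ≤ (P ^ m) v w ∧ (P ^ m) v w ≤ a + δ := by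
  have hpow : ∀ k, (∀ v s, 0 ≤ (P ^ k) v s) ∧ ∀ v, ∑ s, (P ^ k) v s = 1 := by
    intro k
    induction k with
    | zero =>
      refine ⟨fun v s => ?_, fun v => ?_⟩
      · rw [pow_zero, Matrix.one_apply]; split_ifs <;> norm_num
      · simp [Matrix.one_apply]
    | succ k ih =>
      refine ⟨fun v s => ?_, fun v => ?_⟩
      · rw [pow_succ, Matrix.mul_apply]
        exact Finset.sum_nonneg fun i _ => mul_nonneg (ih.1 _ _) (hP _ _)
      · simp_rw [pow_succ, Matrix.mul_apply]
        rw [Finset.sum_comm]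
        simp_rw [← Finset.mul_sum, hrow, mul_one, ih.2]
  have hadd : ∀ k m v, (P ^ (k + m)) v w = ∑ s, (P ^ k) v s * (P ^ m) s w := fun k m v => by
    rw [pow_add, Matrix.mul_apply]
  have hlow : ∀ (k m : ℕ) (a : ℝ), (∀ v, a ≤ (P ^ m) v w) → ∀ v, a ≤ (P ^ (k + m)) v w := by
    intro k m a h v
    rw [hadd]
    calc a = ∑ s, (P ^ k) v s * a := by rw [← Finset.sum_mul, (hpow k).2, one_mul]
      _ ≤ _ := Finset.sum_le_sum fun s _ => mul_le_mul_of_nonneg_left (h s) ((hpow k).1 v s)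
  have hupp : ∀ (k m : ℕ) (b : ℝ), (∀ v, (P ^ m) v w ≤ b) → ∀ v, (P ^ (k + m)) v w ≤ b := by
    intro k m b h v
    rw [hadd]
    calc _ ≤ ∑ s, (P ^ k) v s * b :=
          Finset.sum_le_sum fun s _ => mul_le_mul_of_nonneg_left (h s) ((hpow k).1 v s)
      _ = b := by rw [← Finset.sum_mul, (hpow k).2, one_mul]
  have : Nonempty ι := ⟨u⟩
  obtain ⟨v₀, hv₀⟩ := Finite.exists_min fun v => (P ^ n₀) v u
  set ε := (P ^ n₀) v₀ u with hε
  have hε0 : 0 < ε := hu v₀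
  have hε1 : ε ≤ 1 := by
    rw [← (hpow n₀).2 v₀]
    exact Finset.single_le_sum (fun s _ => (hpow n₀).1 v₀ s) (Finset.mem_univ u)
  obtain ⟨j, hj⟩ := hacc w
  have hpos : ∀ v, ε * (P ^ j) u w ≤ (P ^ (n₀ + j)) v w := by
    intro v
    rw [hadd]
    exact (mul_le_mul_of_nonneg_right (hv₀ v) hj.le).trans
      (Finset.single_le_sum (f := fun s => (P ^ n₀) v s * (P ^ j) s w)
        (fun s _ => mul_nonneg ((hpow n₀).1 v s) ((hpow j).1 s w)) (Finset.mem_univ u))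
  refine ⟨ε * (P ^ j) u w, mul_pos hε0 hj, fun δ hδ => ?_⟩
  -- Every row of `P ^ n₀` puts mass at least `ε` on `u`. Splitting off this common mass leaves
  -- nonnegative weights of total `1 - ε`, so `n₀` more steps shrink the spread of the column by the
  -- factor `1 - ε`.
  have key : ∀ k : ℕ, ∃ M a, ε * (P ^ j) u w ≤ a ∧
      ∀ v, a ≤ (P ^ M) v w ∧ (P ^ M) v w ≤ a + (1 - ε) ^ k := by
    intro k
    induction k with
    | zero =>
      refine ⟨n₀ + j, _, le_rfl, fun v => ⟨hpos v, ?_⟩⟩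
      rw [pow_zero]
      have h1 : (P ^ (n₀ + j)) v w ≤ 1 := by
        rw [← (hpow (n₀ + j)).2 v]
        exact Finset.single_le_sum (fun s _ => (hpow (n₀ + j)).1 v s) (Finset.mem_univ w)
      have h2 : 0 ≤ ε * (P ^ j) u w := (mul_pos hε0 hj).le
      linarith
    | succ k ih =>
      obtain ⟨M, a, ha, hM⟩ := ih
      set g := (P ^ M) u w
      have hga : a ≤ g := (hM u).1
      refine ⟨n₀ + M, ε * g + (1 - ε) * a, by nlinarith, fun v => ?_⟩
      have hsum : (P ^ (n₀ + M)) v w - ε * g =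
          ∑ s, ((P ^ n₀) v s - if s = u then ε else 0) * (P ^ M) s w := by
        rw [hadd]
        simp [sub_mul, Finset.sum_sub_distrib, g]
      have hw0 : ∀ s, 0 ≤ (P ^ n₀) v s - if s = u then ε else 0 := by
        intro s
        split_ifs with h
        · subst h; exact sub_nonneg.2 (hv₀ v)
        · simpa using (hpow n₀).1 v s
      have hw1 : ∑ s, ((P ^ n₀) v s - if s = u then ε else 0) = 1 - ε := by
        simp [Finset.sum_sub_distrib, (hpow n₀).2]
      have h1 : (1 - ε) * a ≤ (P ^ (n₀ + M)) v w - ε * g := by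
        rw [hsum, ← hw1, Finset.sum_mul]
        exact Finset.sum_le_sum fun s _ => mul_le_mul_of_nonneg_left (hM s).1 (hw0 s)
      have h2 : (P ^ (n₀ + M)) v w - ε * g ≤ (1 - ε) * (a + (1 - ε) ^ k) := by
        rw [hsum, ← hw1, Finset.sum_mul, hw1]
        exact Finset.sum_le_sum fun s _ => mul_le_mul_of_nonneg_left (hM s).2 (hw0 s)
      rw [pow_succ]
      constructor <;> linarith
  obtain ⟨k, hk⟩ := exists_pow_lt_of_lt_one hδ (show 1 - ε < 1 by linarith)
  obtain ⟨M, a, ha, hM⟩ := key k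
  refine ⟨M, a, ha, fun m hm v => ?_⟩
  obtain ⟨l, rfl⟩ := Nat.exists_eq_add_of_le' hm
  exact ⟨hlow l M a (fun v => (hM v).1) v, hupp l M _ (fun v => (hM v).2.trans (by linarith)) v⟩

/-- If a nonnegative matrix has a positive left eigenvector `x` and a power with a positive row, and
is irreducible, then every vector `c` with `c ⬝ x > 0` is eventually mapped to the nonnegative
cone. -/
theorem Matrix.eventually_mulVec_pow_nonneg {ι : Type*} [Fintype ι] [DecidableEq ι]
    {A : Matrix ι ι ℝ} (hA : ∀ w v, 0 ≤ A w v) {x : ι → ℝ} (hx : ∀ v, 0 < x v) {lam : ℝ}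
    (hlam : 0 < lam) (heig : ∀ v, ∑ w, A w v * x w = lam * x v) {n₀ : ℕ} {u : ι}
    (hu : ∀ v, 0 < (A ^ n₀) u v) (hacc : ∀ w, ∃ j, 0 < (A ^ j) w u) {c : ι → ℝ}
    (hc : 0 < ∑ v, c v * x v) : ∀ᶠ m in Filter.atTop, ∀ w, 0 ≤ (A ^ m).mulVec c w := by
  -- Conjugating the transpose of `A` by the eigenvector and dividing by `lam` gives a stochastic
  -- matrix; the positive row `u` of `A ^ n₀` becomes a positive column.
  set P : Matrix ι ι ℝ := Matrix.of fun v s => A s v * x s / (lam * x v) with hPdef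
  have hPpow : ∀ m v s, (P ^ m) v s = (A ^ m) s v * x s / (lam ^ m * x v) := by
    intro m
    induction m with
    | zero =>
      intro v s
      rw [pow_zero, pow_zero, pow_zero, Matrix.one_apply, Matrix.one_apply]
      by_cases h : v = s
      · subst h
        simp [(hx v).ne']
      · simp [h, Ne.symm h]
    | succ m ih =>
      intro v s
      rw [pow_succ, pow_succ' A, Matrix.mul_apply, Matrix.mul_apply, Finset.sum_mul,
        Finset.sum_div]
      refine Finset.sum_congr rfl fun t _ => ?_
      rw [ih, hPdef, Matrix.of_apply]
      have h1 := (hx t).ne'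
      have h2 := (hx v).ne'
      have h3 := hlam.ne'
      field_simp
      ring
  have hP : ∀ v s, 0 ≤ P v s := fun v s =>
    div_nonneg (mul_nonneg (hA _ _) (hx _).le) (mul_pos hlam (hx _)).le
  have hrow : ∀ v, ∑ s, P v s = 1 := by
    intro v
    simp only [hPdef, Matrix.of_apply]
    rw [← Finset.sum_div, heig, div_self (mul_pos hlam (hx v)).ne']
  have hu' : ∀ v, 0 < (P ^ n₀) v u := fun v => by
    rw [hPpow]
    exact div_pos (mul_pos (hu v) (hx u)) (mul_pos (pow_pos hlam _) (hx v))
  have hacc' : ∀ w, ∃ j, 0 < (P ^ j) u w := fun w => by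
    obtain ⟨j, hj⟩ := hacc w
    refine ⟨j, ?_⟩
    rw [hPpow]
    exact div_pos (mul_pos hj (hx w)) (mul_pos (pow_pos hlam _) (hx u))
  rw [Filter.eventually_all]
  intro w
  obtain ⟨a₀, ha₀, h⟩ := Matrix.exists_pinched_columns hP hrow hu' hacc' w
  set s := ∑ v, c v * x v
  set T := ∑ v, |c v * x v|
  have hT : 0 < T + 1 := by
    have : 0 ≤ T := Finset.sum_nonneg fun _ _ => abs_nonneg _
    linarith
  -- With this tolerance the error, at most `T` times it, does not exceed the main term `a * s ≥ a₀
  -- * s`; the `+ 1` only avoids a separate bound `T > 0`.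
  obtain ⟨M, a, ha, hM⟩ := h (a₀ * s / (T + 1)) (by positivity)
  filter_upwards [Filter.eventually_ge_atTop M] with m hm
  have hform : (A ^ m).mulVec c w = lam ^ m / x w * ∑ v, (c v * x v) * (P ^ m) v w := by
    rw [Matrix.mulVec, dotProduct, Finset.mul_sum]
    refine Finset.sum_congr rfl fun v _ => ?_
    rw [hPpow]
    have h1 := (hx w).ne'
    have h2 := (hx v).ne'
    have h3 := hlam.ne'
    field_simp
  rw [hform]
  refine mul_nonneg (div_nonneg (pow_pos hlam m).le (hx w).le) ?_
  have h1 : ∑ v, (c v * x v) * (P ^ m) v w =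
      a * s + ∑ v, (c v * x v) * ((P ^ m) v w - a) := by
    rw [Finset.mul_sum, ← Finset.sum_add_distrib]
    exact Finset.sum_congr rfl fun v _ => by ring
  have h2 : -(T * (a₀ * s / (T + 1))) ≤ ∑ v, (c v * x v) * ((P ^ m) v w - a) := by
    rw [Finset.sum_mul, ← Finset.sum_neg_distrib]
    refine Finset.sum_le_sum fun v _ => ?_
    obtain ⟨h3, h4⟩ := hM m hm v
    rw [neg_le_iff_add_nonneg, ← neg_le_iff_add_nonneg']
    calc -(c v * x v * ((P ^ m) v w - a)) ≤ |c v * x v| * ((P ^ m) v w - a) := by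
          rw [← neg_mul]
          exact mul_le_mul_of_nonneg_right (neg_le_abs _) (by linarith)
      _ ≤ _ := mul_le_mul_of_nonneg_left (by linarith) (abs_nonneg _)
  have h3 : T * (a₀ * s / (T + 1)) ≤ a₀ * s := by
    rw [← mul_div_assoc, div_le_iff₀ hT]
    nlinarith [mul_pos ha₀ hc]
  have h4 : a₀ * s ≤ a * s := mul_le_mul_of_nonneg_right ha hc.le
  rw [h1]
  linarith

/-! ### Measures of cylinder sets. -/

namespace StationaryBratteli

universe u

variable {V : Type u} {B : StationaryBratteli V}

/-- Almost every path stays in `α` from some index on, so `Y` is, up to a null set, the increasing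
union of its parts that stay in `α` from `n + N` on. Continuity from below applies to these. -/
theorem measure_le_of_forall_inter_le {μ : Measure B.PathSpace} {α : Set V}
    (hcar : μ (B.eventuallyIn α)ᶜ = 0) {Y : Set B.PathSpace} (n : ℕ) {C : ENNReal}
    (h : ∀ K, μ (Y ∩ {p | p.vertex (n + K) ∈ α}) ≤ C) : μ Y ≤ C := by
  have h1 : μ Y ≤ μ (⋃ N : ℕ, Y ∩ {p | ∀ k, n + N ≤ k → p.vertex k ∈ α}) := by
    calc μ Y ≤ μ ((⋃ N : ℕ, Y ∩ {p | ∀ k, n + N ≤ k → p.vertex k ∈ α}) ∪ (B.eventuallyIn α)ᶜ) := by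
          refine measure_mono fun p hp => ?_
          by_cases hpα : p ∈ B.eventuallyIn α
          · obtain ⟨N, hN⟩ := hpα
            exact Or.inl (Set.mem_iUnion.2 ⟨N, hp, fun k hk => hN k (by omega)⟩)
          · exact Or.inr hpα
      _ ≤ _ := measure_union_le _ _
      _ = _ := by rw [hcar, add_zero]
  refine h1.trans ?_
  rw [Monotone.measure_iUnion]
  · refine iSup_le fun N => le_trans (measure_mono ?_) (h N)
    exact fun p hp => ⟨hp.1, hp.2 (n + N) le_rfl⟩
  · exact fun N M hNM p hp => ⟨hp.1, fun k hk => hp.2 k (by omega)⟩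

theorem IsVertexClass.accesses {α : Set V} (hα : B.IsVertexClass α) {v w : V} (hv : v ∈ α)
    (hw : w ∈ α) : B.Accesses v w := by
  obtain ⟨u, rfl⟩ := hα
  exact hv.2.trans hw.1

theorem IsVertexClass.mem_of_accesses {α : Set V} (hα : B.IsVertexClass α) {v u w : V} (hv : v ∈ α)
    (hw : w ∈ α) (hvu : B.Accesses v u) (huw : B.Accesses u w) : u ∈ α := by
  obtain ⟨t, rfl⟩ := hα
  exact ⟨hv.1.trans hvu, huw.trans hw.2⟩

/-- The vertex `v` has access to the set `α`. -/
def Reaches (B : StationaryBratteli V) (α : Set V) (v : V) : Prop := ∃ w ∈ α, B.Accesses v w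

theorem Reaches.of_edge {α : Set V} {v w : V} (hw : B.Reaches α w) (h : 0 < B.F w v) :
    B.Reaches α v := by
  obtain ⟨u, hu, hwu⟩ := hw
  exact ⟨u, hu, Relation.ReflTransGen.head h hwu⟩

theorem IsVertexClass.mem_of_edge {α : Set V} (hα : B.IsVertexClass α) {v w : V} (hv : v ∈ α)
    (hw : B.Reaches α w) (h : 0 < B.F w v) : w ∈ α := by
  obtain ⟨u, hu, hwu⟩ := hw
  exact hα.mem_of_accesses hv hu (Relation.ReflTransGen.single h) hwu

theorem measure_cyl_lt_top {μ : Measure B.PathSpace} {α : Set V} {v : V}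
    (hv : v ∈ finiteVertices μ α) {n : ℕ} (c : B.FinPath n v) : μ c.cyl < ⊤ := by
  obtain ⟨p, hp⟩ := c.cyl_nonempty
  rw [c.cyl_eq_cylinder hp]
  exact hv.2 p n (c.vertex_eq hp)

variable [Fintype V]

/-- `partialMass B α lam x K v` is `∑ w ∈ α, (A ^ K) v w * x w / lam ^ K`: up to normalization, the
measure of the paths of a cylinder set ending in `v` which are in `α` after `K` more edges. -/
noncomputable def partialMass (B : StationaryBratteli V) (α : Set V) (lam : ℝ) (x : V → ℝ) :
    ℕ → V → ℝ
  | 0, v => α.indicator x v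
  | K + 1, v => (∑ w, (B.F w v : ℝ) * partialMass B α lam x K w) / lam

namespace IsDefinedBy

variable {μ : Measure B.PathSpace} {α : Set V} {lam : ℝ} {x : V → ℝ}

theorem subset_finiteVertices (hμ : IsDefinedBy μ α lam x) : α ⊆ finiteVertices μ α :=
  fun v hv => ⟨⟨v, hv, Relation.ReflTransGen.refl⟩, fun p n hp => by
    rw [hμ.measure_cylinder p n (hp ▸ hv)]
    exact ENNReal.ofReal_lt_top⟩

theorem nonneg (hμ : IsDefinedBy μ α lam x) (v : V) : 0 ≤ x v := by
  by_cases hv : v ∈ finiteVertices μ α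
  · exact (hμ.pos v hv).le
  · exact (hμ.eq_zero v hv).ge

theorem mul_le (hμ : IsDefinedBy μ α lam x) {v : V} (hv : v ∈ finiteVertices μ α) (w : V) :
    (B.F w v : ℝ) * x w ≤ lam * x v := by
  rw [← hμ.eigen v hv]
  exact Finset.single_le_sum (f := fun w => (B.F w v : ℝ) * x w)
    (fun w _ => mul_nonneg (Nat.cast_nonneg _) (hμ.nonneg w)) (Finset.mem_univ w)

theorem exists_mem_eventuallyIn (hμ : IsDefinedBy μ α lam x) (h0 : μ Set.univ = ⊤) :
    ∃ p, p ∈ B.eventuallyIn α := by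
  by_contra! h
  have : (B.eventuallyIn α)ᶜ = Set.univ := Set.eq_univ_of_forall h
  have h1 := hμ.carried
  rw [this, h0] at h1
  exact ENNReal.top_ne_zero h1

theorem lam_pos (hμ : IsDefinedBy μ α lam x) (h0 : μ Set.univ = ⊤) : 0 < lam := by
  obtain ⟨p, N, hN⟩ := hμ.exists_mem_eventuallyIn h0
  have h1 := hμ.subset_finiteVertices (hN N le_rfl)
  have h2 := hμ.subset_finiteVertices (hN (N + 1) (Nat.le_succ N))
  have h3 := hμ.mul_le h1 (p.vertex (N + 1))
  have h4 : (0 : ℝ) < B.F (p.vertex (N + 1)) (p.vertex N) * x (p.vertex (N + 1)) :=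
    mul_pos (Nat.cast_pos.2 (p.F_pos N)) (hμ.pos _ h2)
  exact pos_of_mul_pos_left (h4.trans_le h3) (hμ.nonneg _)

/-- Cylinder sets shrinking to a path that stays in `α` have measures `x v / lam ^ n`, with `x v`
from a finite set of positive numbers. For `lam ≤ 1` these would be bounded below and the path would
be an atom. -/
theorem one_lt_lam (hμ : IsDefinedBy μ α lam x) [NullSingletonClass μ] (h0 : μ Set.univ = ⊤) :
    1 < lam := by
  by_contra! hle
  have hpos := hμ.lam_pos h0
  obtain ⟨p, N, hN⟩ := hμ.exists_mem_eventuallyIn h0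
  have hα : ∀ n, N ≤ n → 0 < x (p.vertex n) := fun n hn =>
    hμ.pos _ (hμ.subset_finiteVertices (hN n hn))
  obtain ⟨δ, hδ, hδx⟩ : ∃ δ > 0, ∀ n, N ≤ n → δ ≤ x (p.vertex n) := by
    have hne : (Set.range fun k => x (p.vertex (N + k))).Finite :=
      (Set.finite_range x).subset (by rintro _ ⟨k, rfl⟩; exact ⟨_, rfl⟩)
    obtain ⟨_, ⟨k, rfl⟩, hk⟩ := Set.exists_min_image _ id hne ⟨_, ⟨0, rfl⟩⟩
    refine ⟨_, hα (N + k) (by omega), fun n hn => ?_⟩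
    obtain ⟨l, rfl⟩ := Nat.exists_eq_add_of_le hn
    exact hk _ ⟨l, rfl⟩
  have hsing : {p} = ⋂ k, p.cylinder (N + k) := by
    ext q
    simp only [Set.mem_singleton_iff, Set.mem_iInter]
    constructor
    · rintro rfl k
      exact ⟨rfl, fun _ _ => rfl⟩
    · intro h
      exact Subtype.ext (Prod.ext (h 0).1 (funext fun k => (h (k + 1)).2 k (by omega)))
  have hlim : Filter.Tendsto (fun k => μ (p.cylinder (N + k))) Filter.atTop (nhds (μ {p})) := by
    rw [hsing]
    refine tendsto_measure_iInter_atTop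
      (fun k => (p.isClopen_cylinder _).2.measurableSet.nullMeasurableSet)
      (fun k l h => p.cylinder_anti (by omega)) ⟨0, ?_⟩
    exact ((hμ.subset_finiteVertices (hN N le_rfl)).2 p N rfl).ne
  rw [measure_singleton] at hlim
  have hge : ENNReal.ofReal δ ≤ 0 := by
    refine ge_of_tendsto' hlim fun k => ?_
    rw [hμ.measure_cylinder p (N + k) (hN _ (by omega))]
    refine ENNReal.ofReal_le_ofReal ((hδx (N + k) (by omega)).trans ?_)
    rw [le_div_iff₀ (pow_pos hpos _)]
    exact mul_le_of_le_one_right (hμ.nonneg _) (pow_le_one₀ hpos.le hle)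
  exact absurd hge (not_le.2 (ENNReal.ofReal_pos.2 hδ))

theorem partialMass_nonneg (hμ : IsDefinedBy μ α lam x) (hl : 0 < lam) :
    ∀ K v, 0 ≤ partialMass B α lam x K v
  | 0, _ => Set.indicator_nonneg (fun _ _ => hμ.nonneg _) _
  | K + 1, _ => div_nonneg (Finset.sum_nonneg fun w _ =>
      mul_nonneg (Nat.cast_nonneg _) (hμ.partialMass_nonneg hl K w)) hl.le

/-- An edge leaving `α` ends where `α` is out of reach and `x` vanishes, so no mass in `α` is lost
at the first step; the recursion preserves the order. -/
theorem partialMass_mono (hμ : IsDefinedBy μ α lam x) (hl : 0 < lam) (v : V) :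
    Monotone fun K => partialMass B α lam x K v := by
  refine monotone_nat_of_le_succ fun K => ?_
  induction K generalizing v with
  | zero =>
    by_cases hv : v ∈ α
    · change α.indicator x v ≤ (∑ w, (B.F w v : ℝ) * α.indicator x w) / lam
      rw [Set.indicator_of_mem hv, le_div_iff₀ hl, mul_comm,
        ← hμ.eigen v (hμ.subset_finiteVertices hv)]
      refine Finset.sum_le_sum fun w _ => ?_
      by_cases hw : w ∈ α
      · rw [Set.indicator_of_mem hw]
      · rw [Set.indicator_of_notMem hw, mul_zero]
        rcases Nat.eq_zero_or_pos (B.F w v) with h | h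
        · simp [h]
        · by_cases hwf : w ∈ finiteVertices μ α
          · exact absurd (hμ.isVertexClass.mem_of_edge hv hwf.1 h) hw
          · rw [hμ.eq_zero w hwf, mul_zero]
    · have h : partialMass B α lam x 0 v = 0 := Set.indicator_of_notMem hv x
      rw [h]
      exact hμ.partialMass_nonneg hl 1 v
  | succ K ih =>
    exact div_le_div_of_nonneg_right (Finset.sum_le_sum fun w _ =>
      mul_le_mul_of_nonneg_left (ih w) (Nat.cast_nonneg _)) hl.le

theorem partialMass_eq_zero (α : Set V) (lam : ℝ) (x : V → ℝ) :
    ∀ (K : ℕ) (v : V), ¬ B.Reaches α v → partialMass B α lam x K v = 0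
  | 0, v, hv => Set.indicator_of_notMem (fun h => hv ⟨v, h, Relation.ReflTransGen.refl⟩) x
  | K + 1, v, hv => by
    rw [partialMass, Finset.sum_eq_zero, zero_div]
    intro w _
    rcases Nat.eq_zero_or_pos (B.F w v) with h | h
    · simp [h]
    · rw [partialMass_eq_zero α lam x K w (fun hw => hv (hw.of_edge h)), mul_zero]

theorem exists_partialMass_pos (hμ : IsDefinedBy μ α lam x) (hl : 0 < lam) {v : V}
    (hv : B.Reaches α v) : ∃ K, 0 < partialMass B α lam x K v := by
  obtain ⟨w, hw, hvw⟩ := hv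
  induction hvw using Relation.ReflTransGen.head_induction_on with
  | refl =>
    refine ⟨0, ?_⟩
    change 0 < α.indicator x w
    rw [Set.indicator_of_mem hw]
    exact hμ.pos w (hμ.subset_finiteVertices hw)
  | head h _ ih =>
    obtain ⟨K, hK⟩ := ih
    refine ⟨K + 1, div_pos (lt_of_lt_of_le (mul_pos (Nat.cast_pos.2 h) hK)
      (Finset.single_le_sum (f := fun w => (B.F w _ : ℝ) * partialMass B α lam x K w)
        (fun w _ => mul_nonneg (Nat.cast_nonneg _) (hμ.partialMass_nonneg hl K w))
        (Finset.mem_univ _))) hl⟩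

/-- Splitting by the first of the `K` further edges matches the recursion of `partialMass`; hence
the induction needs all `n` and `c` at once. -/
theorem measure_cyl_inter (hμ : IsDefinedBy μ α lam x) (hl : 0 < lam) :
    ∀ (K : ℕ) {n : ℕ} {v : V} (c : B.FinPath n v),
      μ (c.cyl ∩ {p | p.vertex (n + K) ∈ α}) =
        ENNReal.ofReal (partialMass B α lam x K v / lam ^ n)
  | 0, n, v, c => by
    change _ = ENNReal.ofReal (α.indicator x v / lam ^ n)
    by_cases hv : v ∈ α
    · have h : c.cyl ∩ {p | p.vertex (n + 0) ∈ α} = c.cyl :=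
        Set.inter_eq_left.2 fun p hp => by
          change p.vertex n ∈ α
          rwa [c.vertex_eq hp]
      rw [h, Set.indicator_of_mem hv]
      obtain ⟨p, hp⟩ := c.cyl_nonempty
      obtain rfl := c.vertex_eq hp
      rw [c.cyl_eq_cylinder hp, hμ.measure_cylinder p n hv]
    · have h : c.cyl ∩ {p | p.vertex (n + 0) ∈ α} = ∅ :=
        Set.eq_empty_of_forall_notMem fun p hp => hv (by
          rw [← c.vertex_eq hp.1]
          exact hp.2)
      rw [h, Set.indicator_of_notMem hv]
      simp
  | K + 1, n, v, c => by
    rw [c.measure_inter_eq_sum μ (isClopen_vertex_mem _ α).2.measurableSet]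
    have h : ∀ w i, μ ((c.snoc w i).cyl ∩ {p | p.vertex (n + (K + 1)) ∈ α}) =
        ENNReal.ofReal (partialMass B α lam x K w / lam ^ (n + 1)) := by
      intro w i
      rw [← hμ.measure_cyl_inter hl K (c.snoc w i), show n + (K + 1) = n + 1 + K by omega]
    have hnn : ∀ w, 0 ≤ partialMass B α lam x K w / lam ^ (n + 1) := fun w =>
      div_nonneg (hμ.partialMass_nonneg hl K w) (pow_pos hl _).le
    simp_rw [h, Finset.sum_const, nsmul_eq_mul, Finset.card_univ, Fintype.card_fin]
    rw [partialMass, div_div, ← pow_succ', Finset.sum_div,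
      ENNReal.ofReal_sum_of_nonneg fun w _ => div_nonneg (mul_nonneg (Nat.cast_nonneg _)
        (hμ.partialMass_nonneg hl K w)) (pow_pos hl _).le]
    refine Finset.sum_congr rfl fun w _ => ?_
    rw [mul_div_assoc, ENNReal.ofReal_mul (Nat.cast_nonneg _), ENNReal.ofReal_natCast]

theorem partialMass_le_of_measure_lt_top (hμ : IsDefinedBy μ α lam x) (hl : 0 < lam) {n : ℕ}
    {v : V} {c : B.FinPath n v} (hc : μ c.cyl < ⊤) :
    BddAbove (Set.range fun K => partialMass B α lam x K v) := by
  refine ⟨(μ c.cyl).toReal * lam ^ n, ?_⟩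
  rintro _ ⟨K, rfl⟩
  rw [← div_le_iff₀ (pow_pos hl n), ← ENNReal.ofReal_le_iff_le_toReal hc.ne,
    ← hμ.measure_cyl_inter hl K c]
  exact measure_mono Set.inter_subset_left

theorem measure_cyl_le (hμ : IsDefinedBy μ α lam x) (hl : 0 < lam) {n : ℕ} {v : V}
    (c : B.FinPath n v) {C : ℝ} (hC : ∀ K, partialMass B α lam x K v ≤ C) :
    μ c.cyl ≤ ENNReal.ofReal (C / lam ^ n) :=
  measure_le_of_forall_inter_le hμ.carried n fun K => by
    rw [hμ.measure_cyl_inter hl K c]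
    exact ENNReal.ofReal_le_ofReal (div_le_div_of_nonneg_right (hC K) (pow_pos hl n).le)

/-- The measure of a cylinder set is controlled by the partial masses of its end vertex, so
finiteness does not depend on the cylinder set chosen. -/
theorem mem_finiteVertices_iff (hμ : IsDefinedBy μ α lam x) (hl : 0 < lam) (v : V) :
    v ∈ finiteVertices μ α ↔ B.Reaches α v ∧
      BddAbove (Set.range fun K => partialMass B α lam x K v) := by
  constructor
  · intro hv
    obtain ⟨c⟩ := FinPath.nonempty (B := B) 0 v
    exact ⟨hv.1, hμ.partialMass_le_of_measure_lt_top hl (measure_cyl_lt_top hv c)⟩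
  · rintro ⟨h1, C, hC⟩
    refine ⟨h1, fun p n hp => ?_⟩
    obtain ⟨c, hc⟩ := FinPath.exists_mem_cyl p n
    subst hp
    rw [← c.cyl_eq_cylinder hc]
    exact (hμ.measure_cyl_le hl c fun K => hC ⟨K, rfl⟩).trans_lt ENNReal.ofReal_lt_top

theorem mem_finiteVertices_of_edge (hμ : IsDefinedBy μ α lam x) (hl : 0 < lam) {v w : V}
    (hv : v ∈ finiteVertices μ α) (h : 0 < B.F w v) (hw : B.Reaches α w) :
    w ∈ finiteVertices μ α := by
  rw [hμ.mem_finiteVertices_iff hl] at hv ⊢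
  obtain ⟨_, C, hC⟩ := hv
  refine ⟨hw, lam * C, ?_⟩
  rintro _ ⟨K, rfl⟩
  have h1 : partialMass B α lam x (K + 1) v ≤ C := hC ⟨K + 1, rfl⟩
  rw [partialMass, div_le_iff₀ hl, mul_comm C] at h1
  have h2 := Finset.single_le_sum (f := fun w => (B.F w v : ℝ) * partialMass B α lam x K w)
    (fun w _ => mul_nonneg (Nat.cast_nonneg _) (hμ.partialMass_nonneg hl K w)) (Finset.mem_univ w)
  have h3 : (1 : ℝ) ≤ B.F w v := by exact_mod_cast h
  have h4 := le_mul_of_one_le_left (hμ.partialMass_nonneg hl K w) h3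
  exact h4.trans (h2.trans h1)

/-- On the finite vertices `x` is a fixed point of the recursion and dominates the starting vector.
-/
theorem partialMass_le (hμ : IsDefinedBy μ α lam x) (hl : 0 < lam) :
    ∀ (K : ℕ) {v : V}, v ∈ finiteVertices μ α → partialMass B α lam x K v ≤ x v
  | 0, v, _ => Set.indicator_le_self' (fun _ _ => hμ.nonneg _) v
  | K + 1, v, hv => by
    rw [partialMass, div_le_iff₀ hl, mul_comm (x v), ← hμ.eigen v hv]
    refine Finset.sum_le_sum fun w _ => ?_
    rcases Nat.eq_zero_or_pos (B.F w v) with h | h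
    · simp [h]
    refine mul_le_mul_of_nonneg_left ?_ (Nat.cast_nonneg _)
    by_cases hw : B.Reaches α w
    · exact hμ.partialMass_le hl K (hμ.mem_finiteVertices_of_edge hl hv h hw)
    · rw [partialMass_eq_zero α lam x K w hw]
      exact hμ.nonneg w

theorem tendsto_partialMass (hμ : IsDefinedBy μ α lam x) (hl : 0 < lam) {v : V}
    (hv : v ∈ finiteVertices μ α) :
    Filter.Tendsto (fun K => partialMass B α lam x K v) Filter.atTop
      (nhds (⨆ K, partialMass B α lam x K v)) :=
  tendsto_atTop_ciSup (hμ.partialMass_mono hl v) ((hμ.mem_finiteVertices_iff hl v).1 hv).2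

theorem iSup_partialMass_eq_zero (α : Set V) (lam : ℝ) (x : V → ℝ) {v : V}
    (hv : ¬ B.Reaches α v) : ⨆ K, partialMass B α lam x K v = 0 := by
  simp [partialMass_eq_zero α lam x _ v hv]

theorem iSup_partialMass_eigen (hμ : IsDefinedBy μ α lam x) (hl : 0 < lam) {v : V}
    (hv : v ∈ finiteVertices μ α) :
    ∑ w, (B.F w v : ℝ) * ⨆ K, partialMass B α lam x K w = lam * ⨆ K, partialMass B α lam x K v := by
  have h1 : Filter.Tendsto (fun K => ∑ w, (B.F w v : ℝ) * partialMass B α lam x K w) Filter.atTop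
      (nhds (∑ w, (B.F w v : ℝ) * ⨆ K, partialMass B α lam x K w)) := by
    refine tendsto_finsetSum _ fun w _ => ?_
    rcases Nat.eq_zero_or_pos (B.F w v) with h | h
    · simp [h]
    refine Filter.Tendsto.const_mul _ ?_
    by_cases hw : B.Reaches α w
    · exact hμ.tendsto_partialMass hl (hμ.mem_finiteVertices_of_edge hl hv h hw)
    · rw [iSup_partialMass_eq_zero α lam x hw]
      simp [partialMass_eq_zero α lam x _ w hw]
  have h2 := ((hμ.tendsto_partialMass hl hv).comp (Filter.tendsto_add_atTop_nat 1)).const_mul lam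
  refine tendsto_nhds_unique h1 (h2.congr fun K => ?_)
  simp only [Function.comp_apply, partialMass]
  field_simp

/-- A vector on the finite vertices which satisfies the eigenvector equation and vanishes on `α` is
zero: the eigenvalue `lam` does not occur outside `α`. -/
theorem eq_zero_of_eigen (hμ : IsDefinedBy μ α lam x) (hl : 0 < lam) {z : V → ℝ}
    (hα : ∀ v ∈ α, z v = 0) (hf : ∀ v, v ∉ finiteVertices μ α → z v = 0)
    (hz : ∀ v ∈ finiteVertices μ α, ∑ w, (B.F w v : ℝ) * z w = lam * z v) (v : V) : z v = 0 := by
  by_cases hv : v ∈ finiteVertices μ α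
  swap
  · exact hf v hv
  set y : V → ℝ := fun v => ⨆ K, partialMass B α lam x K v with hy
  have hle : ∀ K, ∀ v ∈ finiteVertices μ α, partialMass B α lam x K v ≤ y v := fun K v hv =>
    le_ciSup ((hμ.mem_finiteVertices_iff hl v).1 hv).2 K
  have hy0 : ∀ v, 0 ≤ y v := fun v => Real.iSup_nonneg fun K => hμ.partialMass_nonneg hl K v
  have hypos : ∀ v ∈ finiteVertices μ α, 0 < y v := fun v hv => by
    obtain ⟨K, hK⟩ := hμ.exists_partialMass_pos hl hv.1
    exact hK.trans_le (hle K v hv)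
  -- Any `C` with `|z| ≤ C * y` will do; the sum stands in for the maximum.
  set C : ℝ := ∑ v, |z v| / y v
  have hC0 : 0 ≤ C := Finset.sum_nonneg fun v _ => div_nonneg (abs_nonneg _) (hy0 v)
  have hC : ∀ v ∈ finiteVertices μ α, |z v| ≤ C * y v := fun v hv => by
    rw [← div_le_iff₀ (hypos v hv)]
    exact Finset.single_le_sum (f := fun v => |z v| / y v)
      (fun v _ => div_nonneg (abs_nonneg _) (hy0 v)) (Finset.mem_univ v)
  -- Since `z` vanishes on `α`, only the mass not yet in `α` after `K` steps can contribute, and by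
  -- definition of `y` this mass tends to zero.
  have key : ∀ K, ∀ v ∈ finiteVertices μ α, |z v| ≤ C * (y v - partialMass B α lam x K v) := by
    intro K
    induction K with
    | zero =>
      intro v hv
      by_cases hvα : v ∈ α
      · rw [hα v hvα, abs_zero]
        exact mul_nonneg hC0 (sub_nonneg.2 (hle 0 v hv))
      · have h : partialMass B α lam x 0 v = 0 := Set.indicator_of_notMem hvα x
        rw [h, sub_zero]
        exact hC v hv
    | succ K ih =>
      intro v hv
      have h1 : lam * |z v| ≤ ∑ w, (B.F w v : ℝ) * (C * (y w - partialMass B α lam x K w)) := by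
        rw [← abs_of_pos hl, ← abs_mul, ← hz v hv]
        refine (Finset.abs_sum_le_sum_abs _ _).trans (Finset.sum_le_sum fun w _ => ?_)
        rw [abs_mul, Nat.abs_cast, abs_of_pos hl]
        rcases Nat.eq_zero_or_pos (B.F w v) with h | h
        · simp [h]
        refine mul_le_mul_of_nonneg_left ?_ (Nat.cast_nonneg _)
        by_cases hw : B.Reaches α w
        · exact ih w (hμ.mem_finiteVertices_of_edge hl hv h hw)
        · rw [hf w fun h' => hw h'.1, hy]
          simp [iSup_partialMass_eq_zero α lam x hw, partialMass_eq_zero α lam x K w hw]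
      have h2 : ∑ w, (B.F w v : ℝ) * (C * (y w - partialMass B α lam x K w)) =
          C * (lam * y v) - C * ∑ w, (B.F w v : ℝ) * partialMass B α lam x K w := by
        rw [← hμ.iSup_partialMass_eigen hl hv, Finset.mul_sum, Finset.mul_sum,
          ← Finset.sum_sub_distrib]
        exact Finset.sum_congr rfl fun w _ => by ring
      rw [h2] at h1
      refine le_of_mul_le_mul_left (h1.trans_eq ?_) hl
      rw [partialMass]
      field_simp
  have hlim : Filter.Tendsto (fun K => C * (y v - partialMass B α lam x K v)) Filter.atTop
      (nhds (C * (y v - y v))) := (tendsto_const_nhds.sub (hμ.tendsto_partialMass hl hv)).const_mul C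
  have h := ge_of_tendsto' hlim fun K => key K v hv
  rw [sub_self, mul_zero] at h
  exact abs_nonpos_iff.1 h

/-- Both sides satisfy the eigenvector equation and agree on `α`; `eq_zero_of_eigen` applies to
their difference. -/
theorem iSup_partialMass (hμ : IsDefinedBy μ α lam x) (hl : 0 < lam) {v : V}
    (hv : v ∈ finiteVertices μ α) : ⨆ K, partialMass B α lam x K v = x v := by
  classical
  set z : V → ℝ := fun v => if v ∈ finiteVertices μ α then
    (⨆ K, partialMass B α lam x K v) - x v else 0 with hzdef
  have hzf : ∀ v ∈ finiteVertices μ α, z v = (⨆ K, partialMass B α lam x K v) - x v := fun v hv => by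
    simp only [hzdef, if_pos hv]
  have h : z v = 0 := by
    refine hμ.eq_zero_of_eigen hl (z := z) (fun v hv => ?_) (fun v hv => if_neg hv) (fun v hv => ?_) v
    · have hvf := hμ.subset_finiteVertices hv
      rw [hzf v hvf, sub_eq_zero]
      refine le_antisymm (ciSup_le fun K => hμ.partialMass_le hl K hvf) ?_
      have h0 : partialMass B α lam x 0 v = x v := Set.indicator_of_mem hv x
      rw [← h0]
      exact le_ciSup ((hμ.mem_finiteVertices_iff hl v).1 hvf).2 0
    · rw [hzf v hv, mul_sub, ← hμ.iSup_partialMass_eigen hl hv, ← hμ.eigen v hv,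
        ← Finset.sum_sub_distrib]
      refine Finset.sum_congr rfl fun w _ => ?_
      rcases Nat.eq_zero_or_pos (B.F w v) with h | h
      · simp [h]
      by_cases hw : B.Reaches α w
      · rw [hzf w (hμ.mem_finiteVertices_of_edge hl hv h hw), mul_sub]
      · have hw' : w ∉ finiteVertices μ α := fun h' => hw h'.1
        simp [hzdef, hw', hμ.eq_zero w hw', iSup_partialMass_eq_zero α lam x hw]
  rw [hzf v hv] at h
  exact sub_eq_zero.1 h

/-- If `v` is not a finite vertex but this cylinder set has finite measure, then `v` has no access
to `α`, and both sides are zero. -/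
theorem measure_cyl (hμ : IsDefinedBy μ α lam x) (hl : 0 < lam) {n : ℕ} {v : V}
    {c : B.FinPath n v} (hc : μ c.cyl < ⊤) : μ c.cyl = ENNReal.ofReal (x v / lam ^ n) := by
  by_cases hv : v ∈ finiteVertices μ α
  · refine le_antisymm (hμ.measure_cyl_le hl c fun K => hμ.partialMass_le hl K hv) ?_
    have h := hμ.tendsto_partialMass hl hv
    rw [hμ.iSup_partialMass hl hv] at h
    refine le_of_tendsto' ((ENNReal.continuous_ofReal.tendsto _).comp (h.div_const (lam ^ n)))
      fun K => ?_
    rw [Function.comp_apply, ← hμ.measure_cyl_inter hl K c]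
    exact measure_mono Set.inter_subset_left
  · have hr : ¬ B.Reaches α v := fun h => hv ((hμ.mem_finiteVertices_iff hl v).2
      ⟨h, hμ.partialMass_le_of_measure_lt_top hl hc⟩)
    rw [hμ.eq_zero v hv, zero_div, ENNReal.ofReal_zero]
    have h := hμ.measure_cyl_le hl c (C := 0) fun K => (partialMass_eq_zero α lam x K v hr).le
    simpa using h

end IsDefinedBy

end StationaryBratteli

/-! ### Rational dependence of the reduced vector on its entries in the class. -/

/-- Let `E` be a finite-dimensional rational subspace of `ℝ`, stable under multiplication by `lam`.
If `y` solves a linear system with matrix `lam - M`, `M` an integer matrix not having the eigenvalue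
`lam`, and right-hand side in `E`, then its entries are in `E`. -/
theorem Submodule.mem_of_det_ne_zero {ι : Type*} [Fintype ι] [DecidableEq ι] (E : Submodule ℚ ℝ)
    [FiniteDimensional ℚ E] {lam : ℝ} (hE : ∀ e ∈ E, lam * e ∈ E) (M : Matrix ι ι ℤ)
    (hdet : (Matrix.scalar ι lam - M.map (Int.cast : ℤ → ℝ)).det ≠ 0) {y : ι → ℝ}
    (hy : ∀ v, (Matrix.scalar ι lam - M.map (Int.cast : ℤ → ℝ)).mulVec y v ∈ E) (v : ι) :
    y v ∈ E := by
  set N := Matrix.scalar ι lam - M.map (Int.cast : ℤ → ℝ)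
  -- The multipliers of `E` form a ring containing `lam` and the integers, hence also the
  -- determinant and the adjugate entries of `N`; Cramer's rule then puts `N.det * y v` in `E`.
  let R : Subring ℝ :=
    { carrier := {r | ∀ e ∈ E, r * e ∈ E}
      mul_mem' := fun {a b} ha hb e he => by rw [mul_assoc]; exact ha _ (hb e he)
      one_mem' := fun e he => by rwa [one_mul]
      add_mem' := fun {a b} ha hb e he => by rw [add_mul]; exact E.add_mem (ha e he) (hb e he)
      zero_mem' := fun e _ => by rw [zero_mul]; exact E.zero_mem
      neg_mem' := fun {a} ha e he => by rw [neg_mul]; exact E.neg_mem (ha e he) }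
  have hN : ∀ i j, N i j ∈ R := by
    intro i j
    refine R.sub_mem ?_ (intCast_mem R (M i j))
    rw [Matrix.scalar_apply, Matrix.diagonal_apply]
    split_ifs
    · exact hE
    · exact R.zero_mem
  let N' : Matrix ι ι R := Matrix.of fun i j => ⟨N i j, hN i j⟩
  have hNN : N = R.subtype.mapMatrix N' := rfl
  have hadj : ∀ i j, N.adjugate i j ∈ R := by
    intro i j
    rw [hNN, ← RingHom.map_adjugate]
    exact (N'.adjugate i j).2
  have hdetR : N.det ∈ R := by
    rw [hNN, ← RingHom.map_det]
    exact N'.det.2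
  have h1 : N.det * y v ∈ E := by
    have h2 : N.adjugate.mulVec (N.mulVec y) = N.det • y := by
      rw [Matrix.mulVec_mulVec, Matrix.adjugate_mul, Matrix.smul_mulVec, Matrix.one_mulVec]
    have h3 : N.det * y v = (N.adjugate.mulVec (N.mulVec y)) v := by rw [h2]; rfl
    rw [h3]
    exact E.sum_mem fun j _ => hadj v j _ (hy j)
  -- Injective on a finite-dimensional space, hence onto: this is how the determinant is divided out
  -- inside `E`.
  let f : E →ₗ[ℚ] E := (LinearMap.mulLeft ℚ N.det).restrict hdetR
  have hf : Function.Injective f := by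
    intro a b hab
    have : N.det * (a : ℝ) = N.det * b := congrArg Subtype.val hab
    exact Subtype.ext (mul_left_cancel₀ hdet this)
  obtain ⟨e, he⟩ := LinearMap.surjective_of_injective hf ⟨_, h1⟩
  have he' : N.det * (e : ℝ) = N.det * y v := congrArg Subtype.val he
  rw [← mul_left_cancel₀ hdet he']
  exact e.2

theorem exists_nat_forall_mul_eq_sum_int {ι κ : Type*} [Finite ι] [Fintype κ] {y : ι → ℝ}
    {x : κ → ℝ} (h : ∀ i, y i ∈ Submodule.span ℚ (Set.range x)) :
    ∃ D : ℕ, 0 < D ∧ ∀ i, ∃ a : κ → ℤ, (D : ℝ) * y i = ∑ w, (a w : ℝ) * x w := by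
  have h' : ∀ i, ∃ c : κ → ℚ, ∑ w, c w • x w = y i := fun i =>
    (Submodule.mem_span_range_iff_exists_fun ℚ).1 (h i)
  choose c hc using h'
  obtain ⟨b, hb⟩ := IsLocalization.exist_integer_multiples_of_finite (nonZeroDivisors ℤ)
    fun p : ι × κ => c p.1 p.2
  have hb0 : (b : ℤ) ≠ 0 := nonZeroDivisors.ne_zero b.2
  choose a ha using hb
  have ha' : ∀ i w, ((a (i, w) : ℤ) : ℝ) = (b : ℤ) * (c i w : ℝ) := by
    intro i w
    have h1 : ((a (i, w) : ℤ) : ℚ) = (b : ℤ) * c i w := by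
      have := ha (i, w)
      simpa [zsmul_eq_mul] using this
    exact_mod_cast congrArg (Rat.cast : ℚ → ℝ) h1
  -- The common denominator `b` may be negative; its sign moves into the coefficients.
  refine ⟨(b : ℤ).natAbs, Int.natAbs_pos.2 hb0, fun i => ⟨fun w => (b : ℤ).sign * a (i, w), ?_⟩⟩
  have h2 : (((b : ℤ).natAbs : ℕ) : ℝ) = (((b : ℤ).sign * b : ℤ) : ℝ) := by
    rw [Int.sign_mul_self, ← Int.cast_natCast, Int.natCast_natAbs]
  rw [h2, ← hc i, Finset.mul_sum]
  refine Finset.sum_congr rfl fun w _ => ?_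
  simp only [Int.cast_mul, ha', Rat.smul_def]
  ring

namespace StationaryBratteli

universe u

variable {V : Type u} {B : StationaryBratteli V}

namespace IsDefinedBy

variable {μ : Measure B.PathSpace} {α : Set V} {lam : ℝ} {x : V → ℝ}

/-- The finite vertices outside the class `α`. -/
def outer (μ : Measure B.PathSpace) (α : Set V) : Set V := {v | v ∈ finiteVertices μ α ∧ v ∉ α}

/-- The matrix `A_f` restricted to the finite vertices outside `α`. -/
def outerMatrix (μ : Measure B.PathSpace) (α : Set V) : Matrix (outer μ α) (outer μ α) ℤ :=
  Matrix.of fun v w => (B.F w v : ℤ)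

theorem outer_mulVec [Fintype (outer μ α)] [DecidableEq (outer μ α)] (y : V → ℝ)
    (v : outer μ α) :
    (Matrix.scalar (outer μ α) lam - (outerMatrix μ α).map (Int.cast : ℤ → ℝ)).mulVec
      (fun w => y w) v = lam * y v - ∑ w : outer μ α, (B.F w v : ℝ) * y w := by
  rw [Matrix.sub_mulVec, Pi.sub_apply, Matrix.scalar_apply, Matrix.mulVec_diagonal]
  congr 1

variable [Fintype V]

theorem sum_eq_of_mem_class [Fintype α] (hμ : IsDefinedBy μ α lam x) {v : V} (hv : v ∈ α) :
    ∑ w : α, (B.F w v : ℝ) * x w = lam * x v := by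
  rw [← hμ.eigen v (hμ.subset_finiteVertices hv)]
  refine Fintype.sum_of_injective Subtype.val Subtype.val_injective _
    (fun w => (B.F w v : ℝ) * x w) (fun w hw => ?_) fun _ => rfl
  rw [Subtype.range_coe] at hw
  rcases Nat.eq_zero_or_pos (B.F w v) with h | h
  · simp [h]
  by_cases hwf : w ∈ finiteVertices μ α
  · exact absurd (hμ.isVertexClass.mem_of_edge hv hwf.1 h) hw
  · rw [hμ.eq_zero w hwf, mul_zero]

theorem sum_class_add_sum_outer [Fintype α] [Fintype (outer μ α)]
    {f : V → ℝ} (hf : ∀ v, v ∉ finiteVertices μ α → f v = 0) :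
    ∑ w : α, f w + ∑ w : outer μ α, f w = ∑ w, f w := by
  classical
  have h1 : ∑ w : α, f w = ∑ w, if w ∈ α then f w else 0 :=
    Fintype.sum_of_injective Subtype.val Subtype.val_injective _ _
      (fun w hw => if_neg (by rwa [Subtype.range_coe] at hw)) fun w => (if_pos w.2).symm
  have h2 : ∑ w : outer μ α, f w = ∑ w, if w ∈ outer μ α then f w else 0 :=
    Fintype.sum_of_injective Subtype.val Subtype.val_injective _ _
      (fun w hw => if_neg (by rwa [Subtype.range_coe] at hw)) fun w => (if_pos w.2).symm
  rw [h1, h2, ← Finset.sum_add_distrib]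
  refine Finset.sum_congr rfl fun w _ => ?_
  by_cases hw : w ∈ finiteVertices μ α
  · by_cases hwα : w ∈ α
    · rw [if_pos hwα, if_neg fun h : w ∈ outer μ α => h.2 hwα, add_zero]
    · rw [if_neg hwα, if_pos (show w ∈ outer μ α from ⟨hw, hwα⟩), zero_add]
  · rw [hf w hw]
    simp

/-- A kernel vector, extended by zero, would be an eigenvector vanishing on `α`, which
`eq_zero_of_eigen` excludes. -/
theorem det_outer_ne_zero [Fintype (outer μ α)] [DecidableEq (outer μ α)]
    (hμ : IsDefinedBy μ α lam x) (hl : 0 < lam) :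
    (Matrix.scalar (outer μ α) lam - (outerMatrix μ α).map (Int.cast : ℤ → ℝ)).det ≠ 0 := by
  classical
  intro h0
  obtain ⟨z, hz0, hz⟩ := Matrix.exists_mulVec_eq_zero_iff.2 h0
  let z' : V → ℝ := fun v => if h : v ∈ outer μ α then z ⟨v, h⟩ else 0
  have hz' : ∀ v : outer μ α, z' v = z v := fun v => dif_pos v.2
  have hzz : z = fun v : outer μ α => z' v := funext fun v => (hz' v).symm
  have hzn : ∀ v, v ∉ outer μ α → z' v = 0 := fun v h => dif_neg h
  refine hz0 (funext fun v => ?_)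
  rw [← hz' v]
  have hzf : ∀ v, v ∉ finiteVertices μ α → z' v = 0 := fun v hv => hzn v fun h => hv h.1
  have hzα : ∀ v ∈ α, z' v = 0 := fun v hv => hzn v fun h => h.2 hv
  refine hμ.eq_zero_of_eigen hl (z := z') hzα hzf (fun v hv => ?_) v
  by_cases hvα : v ∈ α
  · rw [hzα v hvα, mul_zero]
    refine Finset.sum_eq_zero fun w _ => ?_
    rcases Nat.eq_zero_or_pos (B.F w v) with h | h
    · simp [h]
    by_cases hw : w ∈ outer μ α
    · exact absurd (hμ.isVertexClass.mem_of_edge hvα hw.1.1 h) hw.2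
    · rw [hzn w hw, mul_zero]
  · have h1 := congrFun hz ⟨v, hv, hvα⟩
    rw [hzz, outer_mulVec z' ⟨v, hv, hvα⟩, Pi.zero_apply, sub_eq_zero] at h1
    have : Fintype α := Fintype.ofFinite α
    rw [h1, ← sum_class_add_sum_outer (μ := μ) (α := α) (f := fun w => (B.F w v : ℝ) * z' w) fun w hw => by
      simp [hzf w hw]]
    rw [Finset.sum_eq_zero fun (w : α) _ => ?_, zero_add]
    rw [hzα w w.2, mul_zero]

/-- The rational span of the entries on `α` is stable under `lam`, and the eigenvector equation
outside `α` is a linear system for the remaining entries with right-hand side in this span. -/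
theorem exists_mul_eq_sum_class [Fintype α] (hμ : IsDefinedBy μ α lam x) (hl : 0 < lam) :
    ∃ D : ℕ, 0 < D ∧ ∀ v : outer μ α, ∃ a : α → ℤ, (D : ℝ) * x v = ∑ w, (a w : ℝ) * x w := by
  classical
  have : Fintype (outer μ α) := Fintype.ofFinite _
  refine exists_nat_forall_mul_eq_sum_int fun v => ?_
  set E := Submodule.span ℚ (Set.range fun w : α => x w)
  have hfin : FiniteDimensional ℚ E := FiniteDimensional.span_of_finite ℚ (Set.finite_range _)
  have hx : ∀ w : α, x w ∈ E := fun w => Submodule.subset_span ⟨w, rfl⟩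
  have hnat : ∀ (m : ℕ) {e : ℝ}, e ∈ E → (m : ℝ) * e ∈ E := fun m e he => by
    rw [← nsmul_eq_mul]
    exact E.smul_of_tower_mem m he
  have hE : ∀ e ∈ E, lam * e ∈ E := by
    intro e he
    induction he using Submodule.span_induction with
    | mem e he =>
      obtain ⟨w, rfl⟩ := he
      rw [← hμ.sum_eq_of_mem_class w.2]
      exact E.sum_mem fun u _ => hnat _ (hx u)
    | zero => rw [mul_zero]; exact E.zero_mem
    | add a b _ _ ha hb => rw [mul_add]; exact E.add_mem ha hb
    | smul q a _ ha => rw [mul_smul_comm]; exact E.smul_mem q ha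
  refine Submodule.mem_of_det_ne_zero E hE (outerMatrix μ α) (hμ.det_outer_ne_zero hl)
    (y := fun w : outer μ α => x w) (fun v => ?_) v
  rw [outer_mulVec, ← hμ.eigen v v.2.1, ← sum_class_add_sum_outer (μ := μ) (α := α)
    (f := fun w => (B.F w v : ℝ) * x w) fun w hw => by simp [hμ.eq_zero w hw], add_sub_cancel_right]
  exact E.sum_mem fun u _ => hnat _ (hx u)

/-- Every element of the group generated by the reduced vector is an integral combination of its
entries with coefficients in `[0, D)` outside `α`. -/
theorem exists_reduced_combination [Fintype α] (hμ : IsDefinedBy μ α lam x) (hl : 0 < lam) :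
    ∃ D : ℕ, ∀ h ∈ AddSubgroup.closure (Set.range x), ∃ (r : V → ℕ) (k : α → ℤ),
      (∀ v, r v ≤ D) ∧ (∀ v, v ∉ outer μ α → r v = 0) ∧
        h = ∑ v, (r v : ℝ) * x v + ∑ w, (k w : ℝ) * x w := by
  classical
  obtain ⟨D, hD0, hD⟩ := hμ.exists_mul_eq_sum_class hl
  refine ⟨D, fun h hh => ?_⟩
  obtain ⟨a, rfl⟩ := AddSubgroup.mem_closure_range_iff_of_fintype.1 hh
  have key : ∀ v, ∃ (r : ℕ) (k : α → ℤ), r ≤ D ∧ (v ∉ outer μ α → r = 0) ∧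
      a v • x v = (r : ℝ) * x v + ∑ w, (k w : ℝ) * x w := by
    intro v
    by_cases hv : v ∈ outer μ α
    · obtain ⟨k, hk⟩ := hD ⟨v, hv⟩
      have hD' : (0 : ℤ) < D := by exact_mod_cast hD0
      have hr := Int.emod_nonneg (a v) hD'.ne'
      -- Division with remainder: multiples of `D * x v` are moved into `α`, and the remainder stays
      -- at `v`.
      refine ⟨(a v % D).toNat, fun w => (a v / D) * k w, ?_, fun h => absurd hv h, ?_⟩
      · have := Int.emod_lt_of_pos (a v) hD'
        omega
      · have h1 : (((a v % D).toNat : ℕ) : ℝ) = ((a v % D : ℤ) : ℝ) := by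
          exact_mod_cast congrArg (Int.cast : ℤ → ℝ) (Int.toNat_of_nonneg hr)
        have h2 : ((a v : ℤ) : ℝ) = ((a v % D : ℤ) : ℝ) + (D : ℝ) * ((a v / D : ℤ) : ℝ) := by
          exact_mod_cast congrArg (Int.cast : ℤ → ℝ) (Int.emod_add_mul_ediv (a v) D).symm
        simp only [Int.cast_mul, mul_assoc]
        rw [← Finset.mul_sum, ← hk, h1, zsmul_eq_mul, h2]
        ring
    · by_cases hvα : v ∈ α
      · refine ⟨0, Pi.single ⟨v, hvα⟩ (a v), Nat.zero_le _, fun _ => rfl, ?_⟩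
        rw [Finset.sum_eq_single ⟨v, hvα⟩]
        · simp
        · intro w _ hw
          simp [hw]
        · simp
      · refine ⟨0, 0, Nat.zero_le _, fun _ => rfl, ?_⟩
        rw [hμ.eq_zero v fun h => hv ⟨h, hvα⟩]
        simp
  choose r k h1 h2 h3 using key
  refine ⟨r, fun w => ∑ v, k v w, h1, h2, ?_⟩
  simp_rw [h3, Finset.sum_add_distrib, Int.cast_sum, Finset.sum_mul]
  rw [Finset.sum_comm (s := (Finset.univ : Finset V))]

end IsDefinedBy

end StationaryBratteli

/-! ### Ergodicity and the matrix of the class. -/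

namespace StationaryBratteli

universe u

variable {V : Type u} {B : StationaryBratteli V}

/-- The matrix `F` restricted to `α`. -/
def classMatrix (B : StationaryBratteli V) (α : Set V) : Matrix α α ℤ :=
  Matrix.of fun w v => (B.F w v : ℤ)

theorem vertex_mem_class {α : Set V} (hα : B.IsVertexClass α) {p : B.PathSpace}
    (hp : p ∈ B.eventuallyIn α) (h0 : p.vertex 0 ∈ α) (n : ℕ) : p.vertex n ∈ α := by
  have acc : ∀ m k, B.Accesses (p.vertex m) (p.vertex (m + k)) := by
    intro m k
    induction k with
    | zero => exact Relation.ReflTransGen.refl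
    | succ k ih => exact ih.tail (p.F_pos (m + k))
  obtain ⟨N, hN⟩ := hp
  have h := acc 0 n
  rw [zero_add] at h
  exact hα.mem_of_accesses h0 (hN (n + N) (by omega)) h (acc n N)

section

variable {α : Set V} [Fintype α] [DecidableEq α]

theorem classMatrix_pow_nonneg : ∀ (n : ℕ) (w v : α), 0 ≤ (B.classMatrix α ^ n) w v
  | 0, w, v => by
    rw [pow_zero, Matrix.one_apply]
    split_ifs <;> norm_num
  | n + 1, w, v => by
    rw [pow_succ', Matrix.mul_apply]
    exact Finset.sum_nonneg fun u _ =>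
      mul_nonneg (Nat.cast_nonneg _) (classMatrix_pow_nonneg n u v)

theorem classMatrix_pow_succ_pos {n : ℕ} {w u v : α} (h : 0 < B.F w u)
    (hu : 0 < (B.classMatrix α ^ n) u v) : 0 < (B.classMatrix α ^ (n + 1)) w v := by
  rw [pow_succ', Matrix.mul_apply]
  refine lt_of_lt_of_le (mul_pos (Nat.cast_pos.2 h) hu)
    (Finset.single_le_sum (f := fun u => B.classMatrix α w u * (B.classMatrix α ^ n) u v)
      (fun u _ => mul_nonneg (Nat.cast_nonneg _) (classMatrix_pow_nonneg n u v))
      (Finset.mem_univ u))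

/-- A finite path between two vertices of `α` never leaves `α`, so the restricted matrix counts it.
-/
theorem IsVertexClass.exists_classMatrix_pow_pos (hα : B.IsVertexClass α) (v w : α) :
    ∃ n, 0 < (B.classMatrix α ^ n) w v := by
  have key : ∀ u, B.Accesses v u → ∀ hu : u ∈ α, ∃ n, 0 < (B.classMatrix α ^ n) ⟨u, hu⟩ v := by
    intro u hvu
    induction hvu with
    | refl => exact fun _ => ⟨0, by simp⟩
    | @tail a b hva hab ih =>
      intro hb
      have ha : a ∈ α := hα.mem_of_accesses v.2 hb hva (Relation.ReflTransGen.single hab)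
      obtain ⟨n, hn⟩ := ih ha
      exact ⟨n + 1, classMatrix_pow_succ_pos (w := ⟨b, hb⟩) (u := ⟨a, ha⟩) hab hn⟩
  exact key w (hα.accesses v.2 w.2) w.2

/-- The vertices of `α` which are reached from `v` inside `α` in exactly `n` steps. -/
def reachedIn (B : StationaryBratteli V) (v : α) (n : ℕ) : Set V :=
  {w | ∃ h : w ∈ α, 0 < (B.classMatrix α ^ n) ⟨w, h⟩ v}

/-- The infinite paths which from some level on are compatible with having passed through `v` on the
first level. -/
def compatible (B : StationaryBratteli V) (v : α) : Set B.PathSpace :=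
  ⋃ N : ℕ, ⋂ n : ℕ, ⋂ (_ : N ≤ n), {p | p.vertex n ∈ B.reachedIn v n}

theorem mem_compatible {v : α} {p : B.PathSpace} :
    p ∈ B.compatible v ↔ ∃ N, ∀ n, N ≤ n → p.vertex n ∈ B.reachedIn v n := by
  simp only [compatible, Set.mem_iUnion, Set.mem_iInter, Set.mem_ofPred_eq]

theorem measurableSet_compatible (v : α) : MeasurableSet (B.compatible v) :=
  MeasurableSet.iUnion fun _ => MeasurableSet.iInter fun _ => MeasurableSet.iInter fun _ =>
    (isClopen_vertex_mem _ _).2.measurableSet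

theorem mem_compatible_of_vertex_zero (hα : B.IsVertexClass α) {p : B.PathSpace}
    (hp : p ∈ B.eventuallyIn α) {v : α} (h0 : p.vertex 0 = v) : p ∈ B.compatible v := by
  have hmem := vertex_mem_class hα hp (h0 ▸ v.2)
  refine mem_compatible.2 ⟨0, fun n _ => ?_⟩
  induction n with
  | zero =>
    refine ⟨hmem 0, ?_⟩
    have : (⟨p.vertex 0, hmem 0⟩ : α) = v := Subtype.ext h0
    rw [this]
    simp
  | succ n ih =>
    obtain ⟨h, hn⟩ := ih (Nat.zero_le n)
    exact ⟨hmem (n + 1), classMatrix_pow_succ_pos (w := ⟨_, hmem (n + 1)⟩) (p.F_pos n) hn⟩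

end

variable [Fintype V] {μ : Measure B.PathSpace} {α : Set V} [Fintype α] [DecidableEq α] {lam : ℝ}
  {x : V → ℝ}

/-- The compatible paths are a union of tail classes and contain almost all of a first-level
cylinder set ending in `v`, whose measure `x v` is positive. -/
theorem IsDefinedBy.measure_compatible_compl (hμ : IsDefinedBy μ α lam x) (herg : TailErgodic μ)
    (v : α) : μ (B.compatible v)ᶜ = 0 := by
  refine (herg _ (measurableSet_compatible v) fun p hp q hpq => ?_).resolve_left fun h0 => ?_
  · obtain ⟨N, hN⟩ := mem_compatible.1 hp
    obtain ⟨M, hM⟩ := hpq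
    refine mem_compatible.2 ⟨max N M, fun n hn => ?_⟩
    have h := hN n ((le_max_left _ _).trans hn)
    rwa [PathSpace.vertex, hM n ((le_max_right _ _).trans hn)] at h
  · obtain ⟨c⟩ := FinPath.nonempty (B := B) 0 v.1
    have h1 : μ c.cyl ≤ μ (B.compatible v ∪ (B.eventuallyIn α)ᶜ) := by
      refine measure_mono fun p hp => ?_
      by_cases h : p ∈ B.eventuallyIn α
      · exact Or.inl (mem_compatible_of_vertex_zero hμ.isVertexClass h (c.vertex_eq hp))
      · exact Or.inr h
    rw [measure_union_null h0 hμ.carried, nonpos_iff_eq_zero] at h1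
    obtain ⟨p, hp⟩ := c.cyl_nonempty
    have hv := c.vertex_eq hp
    rw [c.cyl_eq_cylinder hp, hμ.measure_cylinder p 0 (hv ▸ v.2), pow_zero, div_one, hv,
      ENNReal.ofReal_eq_zero] at h1
    exact absurd h1 (not_le.2 (hμ.pos _ (hμ.subset_finiteVertices v.2)))

/-- Ergodicity forces some power of the matrix of `α` to have a positive row. -/
theorem IsDefinedBy.exists_positive_row (hμ : IsDefinedBy μ α lam x) (herg : TailErgodic μ)
    (h0 : μ Set.univ = ⊤) : ∃ (n : ℕ) (u : α), ∀ v, 0 < (B.classMatrix α ^ n) u v := by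
  have hnull : μ (⋃ v : α, (B.compatible v)ᶜ) = 0 :=
    measure_iUnion_null fun v => hμ.measure_compatible_compl herg v
  have hex : ∃ p, ∀ v : α, p ∈ B.compatible v := by
    by_contra! h
    have : (⋃ v : α, (B.compatible v)ᶜ) = Set.univ := Set.eq_univ_of_forall fun p => by
      obtain ⟨v, hv⟩ := h p
      exact Set.mem_iUnion.2 ⟨v, hv⟩
    rw [this, h0] at hnull
    exact ENNReal.top_ne_zero hnull
  obtain ⟨p, hp⟩ := hex
  choose N hN using fun v => mem_compatible.1 (hp v)
  -- At this common index the vertex of `p` is reached from every `v ∈ α` in exactly `n` steps,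
  -- which gives the positive row.
  set n := Finset.univ.sup N
  have h1 : ∀ v, p.vertex n ∈ B.reachedIn v n := fun v =>
    hN v n (Finset.le_sup (Finset.mem_univ v))
  obtain ⟨t, ht⟩ := hμ.isVertexClass
  have htα : t ∈ α := by
    rw [ht]
    exact ⟨Relation.ReflTransGen.refl, Relation.ReflTransGen.refl⟩
  exact ⟨n, ⟨p.vertex n, (h1 ⟨t, htα⟩).1⟩, fun v => (h1 v).2⟩

theorem IsDefinedBy.eventually_mulVec_nonneg (hμ : IsDefinedBy μ α lam x) (herg : TailErgodic μ)
    (h0 : μ Set.univ = ⊤) {c : α → ℤ} (hc : 0 < ∑ v, (c v : ℝ) * x v) :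
    ∀ᶠ m in Filter.atTop, ∀ w, 0 ≤ (B.classMatrix α ^ m).mulVec c w := by
  obtain ⟨n, u, hu⟩ := hμ.exists_positive_row herg h0
  set A : Matrix α α ℝ := (Int.castRingHom ℝ).mapMatrix (B.classMatrix α) with hA
  have hpow : ∀ m w v, (A ^ m) w v = ((B.classMatrix α ^ m) w v : ℤ) := by
    intro m w v
    rw [hA, ← map_pow]
    rfl
  have h := Matrix.eventually_mulVec_pow_nonneg (A := A) (x := fun v => x v) (lam := lam) (n₀ := n)
    (u := u) (c := fun v => (c v : ℝ)) (fun w v => ?_)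
    (fun v => hμ.pos _ (hμ.subset_finiteVertices v.2)) (hμ.lam_pos h0) (fun v => ?_) (fun v => ?_)
    (fun w => ?_) hc
  · filter_upwards [h] with m hm w
    have h1 := hm w
    have h2 : (A ^ m).mulVec (fun v => (c v : ℝ)) w = ((B.classMatrix α ^ m).mulVec c w : ℤ) := by
      simp only [Matrix.mulVec, dotProduct, hpow, Int.cast_sum, Int.cast_mul]
    rw [h2] at h1
    exact_mod_cast h1
  · exact Int.cast_nonneg (Nat.cast_nonneg _)
  · rw [← hμ.sum_eq_of_mem_class v.2]
    rfl
  · rw [hpow]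
    exact Int.cast_pos.2 (hu v)
  · obtain ⟨j, hj⟩ := hμ.isVertexClass.exists_classMatrix_pow_pos u w
    refine ⟨j, ?_⟩
    rw [hpow]
    exact Int.cast_pos.2 hj

end StationaryBratteli

/-! ### Realizing group elements by clopen sets. -/

namespace StationaryBratteli

universe u

variable {V : Type u} {B : StationaryBratteli V}

/-- Restriction of a family to paths ending in `α`. -/
theorem PathFamily.exists_inter_eq {n : ℕ} (T : B.PathFamily n) (α : Set V) :
    ∃ T' : B.PathFamily n, (∀ w ∈ α, T' w = T w) ∧ (∀ w, w ∉ α → T' w = ∅) ∧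
      T'.carrier = T.carrier ∩ {p | p.vertex n ∈ α} := by
  classical
  refine ⟨fun w => if w ∈ α then T w else ∅, fun w hw => if_pos hw, fun w hw => if_neg hw, ?_⟩
  ext p
  obtain ⟨c, hc⟩ := FinPath.exists_mem_cyl p n
  rw [Set.mem_inter_iff, PathFamily.mem_carrier_iff _ hc, PathFamily.mem_carrier_iff _ hc,
    Set.mem_ofPred_eq]
  by_cases h : p.vertex n ∈ α <;> simp [h]

variable [Fintype V]

/-- Only an inequality, since paths of `T` ending outside `α` may enter `α` later. -/
theorem mulVec_card_le_card_extendBy {α : Set V} [Fintype α] [DecidableEq α] {n : ℕ}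
    (T : B.PathFamily n) (m : ℕ) (w : α) :
    (B.classMatrix α ^ m).mulVec (fun v => ((T v).card : ℤ)) w ≤ ((T.extendBy m w).card : ℤ) := by
  classical
  induction m generalizing w with
  | zero => rw [pow_zero, Matrix.one_mulVec]; rfl
  | succ m ih =>
    rw [pow_succ', ← Matrix.mulVec_mulVec]
    calc (B.classMatrix α).mulVec
          ((B.classMatrix α ^ m).mulVec (fun v => ((T v).card : ℤ))) w
        ≤ ∑ v : α, (B.F w v : ℤ) * ((T.extendBy m v).card : ℤ) :=
          Finset.sum_le_sum fun v _ => mul_le_mul_of_nonneg_left (ih v) (Nat.cast_nonneg _)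
      _ = ∑ v, if v ∈ α then (B.F w v : ℤ) * ((T.extendBy m v).card : ℤ) else 0 :=
          Fintype.sum_of_injective Subtype.val Subtype.val_injective _ _
            (fun v hv => if_neg (by rwa [Subtype.range_coe] at hv)) fun v => (if_pos v.2).symm
      _ ≤ ∑ v, (B.F w v : ℤ) * ((T.extendBy m v).card : ℤ) := by
          refine Finset.sum_le_sum fun v _ => ?_
          split_ifs
          · exact le_rfl
          · positivity
      _ = ((T.extendBy (m + 1) w).card : ℤ) := by
          rw [PathFamily.extendBy, PathFamily.card_extend]
          push_cast
          rfl

namespace IsDefinedBy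

variable {μ : Measure B.PathSpace} {α : Set V} {lam : ℝ} {x : V → ℝ}

theorem sum_mulVec_pow [Fintype α] [DecidableEq α] (hμ : IsDefinedBy μ α lam x) (k : α → ℤ)
    (j : ℕ) : ∑ w, (((B.classMatrix α ^ j).mulVec k w : ℤ) : ℝ) * x w =
      lam ^ j * ∑ w, (k w : ℝ) * x w := by
  induction j with
  | zero => simp
  | succ j ih =>
    rw [pow_succ' lam, mul_assoc, ← ih, Finset.mul_sum]
    simp_rw [pow_succ', ← Matrix.mulVec_mulVec]
    set y := (B.classMatrix α ^ j).mulVec k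
    have h : ∀ w, (((B.classMatrix α).mulVec y w : ℤ) : ℝ) * x w =
        ∑ v : α, (y v : ℝ) * ((B.F w v : ℝ) * x w) := by
      intro w
      simp only [Matrix.mulVec, dotProduct, classMatrix, Matrix.of_apply, Int.cast_sum,
        Int.cast_mul, Int.cast_natCast, Finset.sum_mul]
      exact Finset.sum_congr rfl fun v _ => by ring
    simp_rw [h]
    rw [Finset.sum_comm]
    refine Finset.sum_congr rfl fun v _ => ?_
    rw [← Finset.mul_sum, hμ.sum_eq_of_mem_class v.2]
    ring

theorem measure_carrier (hμ : IsDefinedBy μ α lam x) (hl : 0 < lam) {n : ℕ} {S : B.PathFamily n}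
    (hS : ∀ w, ∀ c ∈ S w, μ c.cyl < ⊤) :
    μ S.carrier = ENNReal.ofReal ((∑ w, ((S w).card : ℝ) * x w) / lam ^ n) := by
  have hnn : ∀ w, 0 ≤ x w / lam ^ n := fun w => div_nonneg (hμ.nonneg w) (pow_pos hl n).le
  rw [S.measure_carrier μ, Finset.sum_div, ENNReal.ofReal_sum_of_nonneg fun w _ => by
    rw [mul_div_assoc]
    exact mul_nonneg (Nat.cast_nonneg _) (hnn w)]
  refine Finset.sum_congr rfl fun w _ => ?_
  rw [Finset.sum_congr rfl fun c hc => hμ.measure_cyl hl (hS w c hc), Finset.sum_const,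
    nsmul_eq_mul, mul_div_assoc, ENNReal.ofReal_mul (Nat.cast_nonneg _), ENNReal.ofReal_natCast]

theorem lam_mul_mem (hμ : IsDefinedBy μ α lam x) {h : ℝ}
    (hh : h ∈ AddSubgroup.closure (Set.range x)) (j : ℕ) :
    lam ^ j * h ∈ AddSubgroup.closure (Set.range x) := by
  have hstep : ∀ h ∈ AddSubgroup.closure (Set.range x),
      lam * h ∈ AddSubgroup.closure (Set.range x) := by
    intro h hh
    induction hh using AddSubgroup.closure_induction with
    | mem h hh =>
      obtain ⟨v, rfl⟩ := hh
      by_cases hv : v ∈ finiteVertices μ α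
      · rw [← hμ.eigen v hv]
        refine AddSubgroup.sum_mem _ fun w _ => ?_
        rw [← nsmul_eq_mul]
        exact AddSubgroup.nsmul_mem _ (AddSubgroup.subset_closure (Set.mem_range_self w)) _
      · rw [hμ.eq_zero v hv, mul_zero]
        exact AddSubgroup.zero_mem _
    | zero => rw [mul_zero]; exact AddSubgroup.zero_mem _
    | add a b _ _ ha hb => rw [mul_add]; exact AddSubgroup.add_mem _ ha hb
    | neg a _ ha => rw [mul_neg]; exact AddSubgroup.neg_mem _ ha
  induction j with
  | zero => rwa [pow_zero, one_mul]
  | succ j ih => rw [pow_succ', mul_assoc]; exact hstep _ ih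

/-- The group `⋃ N, lam ^ (-N) H`. -/
def valueGroup (hμ : IsDefinedBy μ α lam x) : AddSubgroup ℝ where
  carrier := {t | ∃ N : ℕ, lam ^ N * t ∈ AddSubgroup.closure (Set.range x)}
  zero_mem' := ⟨0, by simp⟩
  add_mem' := by
    rintro a b ⟨N, hN⟩ ⟨M, hM⟩
    refine ⟨N + M, ?_⟩
    rw [mul_add]
    refine AddSubgroup.add_mem _ ?_ ?_
    · rw [add_comm, pow_add, mul_assoc]
      exact hμ.lam_mul_mem hN M
    · rw [pow_add, mul_assoc]
      exact hμ.lam_mul_mem hM N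
  neg_mem' := by
    rintro a ⟨N, hN⟩
    refine ⟨N, ?_⟩
    rw [mul_neg]
    exact AddSubgroup.neg_mem _ hN

theorem coe_valueGroup (hμ : IsDefinedBy μ α lam x) (hl : 0 < lam) :
    (hμ.valueGroup : Set ℝ) = ⋃ N : ℕ, (fun h : ℝ => 1 / lam ^ N * h) ''
      (AddSubgroup.closure (Set.range x) : Set ℝ) := by
  ext t
  simp only [Set.mem_iUnion, Set.mem_image, SetLike.mem_coe]
  have hp : ∀ N : ℕ, lam ^ N ≠ 0 := fun N => (pow_pos hl N).ne'
  constructor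
  · rintro ⟨N, hN⟩
    refine ⟨N, _, hN, ?_⟩
    have := hp N
    field_simp
  · rintro ⟨N, h, hh, rfl⟩
    refine ⟨N, ?_⟩
    have := hp N
    rwa [← mul_assoc, mul_one_div_cancel this, one_mul]

theorem clopenValues_subset (hμ : IsDefinedBy μ α lam x) (hl : 0 < lam) :
    clopenValues μ ⊆ (hμ.valueGroup : Set ℝ) ∩ Set.Ici 0 := by
  rintro _ ⟨U, hU, hfin, rfl⟩
  refine ⟨?_, ENNReal.toReal_nonneg⟩
  obtain ⟨n, S, rfl⟩ := PathFamily.exists_carrier_eq hU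
  have hS : ∀ w, ∀ c ∈ S w, μ c.cyl < ⊤ := fun w c hc =>
    (measure_mono (t := S.carrier) fun p hp => ⟨w, c, hc, hp⟩).trans_lt hfin
  have hnn : 0 ≤ (∑ w, ((S w).card : ℝ) * x w) / lam ^ n :=
    div_nonneg (Finset.sum_nonneg fun w _ => mul_nonneg (Nat.cast_nonneg _) (hμ.nonneg w))
      (pow_pos hl n).le
  rw [hμ.measure_carrier hl hS, ENNReal.toReal_ofReal hnn]
  refine ⟨n, ?_⟩
  rw [mul_div_cancel₀ _ (pow_pos hl n).ne']
  refine AddSubgroup.sum_mem _ fun w _ => ?_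
  rw [← nsmul_eq_mul]
  exact AddSubgroup.nsmul_mem _ (AddSubgroup.subset_closure (Set.mem_range_self w)) _

theorem sum_card_mul_eq [Fintype α] {n : ℕ} {T : B.PathFamily n} (hT : ∀ w, w ∉ α → T w = ∅) :
    ∑ w, ((T w).card : ℝ) * x w = ∑ w : α, ((T w).card : ℝ) * x w :=
  (Fintype.sum_of_injective Subtype.val Subtype.val_injective _ (fun w => ((T w).card : ℝ) * x w)
    (fun w hw => by rw [Subtype.range_coe] at hw; simp [hT w hw]) fun _ => rfl).symm

/-- Inside a set of finite paths carrying infinite measure, every sufficiently small integral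
combination of the measures of cylinder sets ending in `α` is realized. -/
theorem exists_family_of_class_combination [Fintype α] (hμ : IsDefinedBy μ α lam x)
    (herg : TailErgodic μ) (h0 : μ Set.univ = ⊤) {n : ℕ} {T : B.PathFamily n}
    (hT : μ T.carrier = ⊤) {k : α → ℤ} (hk : 0 < ∑ w, (k w : ℝ) * x w) :
    ∃ (m : ℕ) (S : B.PathFamily m), S.carrier ⊆ T.carrier ∧
      μ S.carrier = ENNReal.ofReal ((∑ w, (k w : ℝ) * x w) / lam ^ n) := by
  classical
  have hl := hμ.lam_pos h0
  have hfin : ∀ {w : V}, w ∈ α → ∀ {n : ℕ} (c : B.FinPath n w), μ c.cyl < ⊤ := fun hw _ c =>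
    measure_cyl_lt_top (hμ.subset_finiteVertices hw) c
  -- Otherwise the finite target value would bound `μ T.carrier`.
  obtain ⟨j, hj⟩ : ∃ j, ENNReal.ofReal ((∑ w, (k w : ℝ) * x w) / lam ^ n) <
      μ (T.carrier ∩ {p | p.vertex (n + j) ∈ α}) := by
    by_contra! h
    have := measure_le_of_forall_inter_le hμ.carried n h
    rw [hT, top_le_iff] at this
    exact ENNReal.ofReal_ne_top this
  set T₁ := T.extendBy j with hT₁
  obtain ⟨T', h1, h2, h3⟩ := T₁.exists_inter_eq α
  rw [hT₁, T.carrier_extendBy j] at h3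
  rw [← h3, hμ.measure_carrier hl fun w c hc => by
      by_cases hw : w ∈ α
      · exact hfin hw c
      · rw [h2 w hw] at hc
        exact absurd hc (Finset.notMem_empty c), sum_card_mul_eq h2,
    ENNReal.ofReal_lt_ofReal_iff_of_nonneg (div_pos hk (pow_pos hl n)).le,
    div_lt_div_iff₀ (pow_pos hl _) (pow_pos hl _), pow_add, mul_comm (lam ^ n), ← mul_assoc] at hj
  have hj' := lt_of_mul_lt_mul_right hj (pow_pos hl n).le
  -- Available minus wanted path counts at index `n + j`; by the choice of `j` the difference pairs
  -- positively with `x`.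
  set c : α → ℤ := (fun w : α => ((T₁ w).card : ℤ)) - (B.classMatrix α ^ j).mulVec k with hcdef
  have hc : 0 < ∑ w, (c w : ℝ) * x w := by
    have : ∑ w, (c w : ℝ) * x w =
        ∑ w : α, ((T' w).card : ℝ) * x w - lam ^ j * ∑ w, (k w : ℝ) * x w := by
      rw [← hμ.sum_mulVec_pow k j, ← Finset.sum_sub_distrib]
      refine Finset.sum_congr rfl fun w _ => ?_
      rw [h1 w w.2, hcdef, Pi.sub_apply, Int.cast_sub, Int.cast_natCast, sub_mul]
    rw [this, mul_comm]
    linarith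
  -- After `m` more edges the wanted counts are nonnegative and at most the available ones.
  obtain ⟨m, hm1, hm2⟩ := ((hμ.eventually_mulVec_nonneg herg h0 hc).and
    ((Filter.tendsto_add_atTop_nat j).eventually (hμ.eventually_mulVec_nonneg herg h0 hk))).exists
  set κ := (B.classMatrix α ^ (m + j)).mulVec k
  have hle : ∀ w : α, (κ w).toNat ≤ (T₁.extendBy m w).card := by
    intro w
    have ha := hm1 w
    rw [hcdef, Matrix.mulVec_sub, Matrix.mulVec_mulVec, ← pow_add, Pi.sub_apply] at ha
    have hb := mulVec_card_le_card_extendBy T₁ m w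
    have : κ w ≤ ((T₁.extendBy m w).card : ℤ) := by
      change 0 ≤ _ - κ w at ha
      linarith
    omega
  choose S' hS' hS'card using fun w : α => Finset.exists_subset_card_eq (hle w)
  set S : B.PathFamily (n + j + m) := fun w => if h : w ∈ α then S' ⟨w, h⟩ else ∅ with hS
  have hSα : ∀ w : α, S w = S' w := fun w => dif_pos w.2
  have hSn : ∀ w, w ∉ α → S w = ∅ := fun w hw => dif_neg hw
  refine ⟨n + j + m, S, ?_, ?_⟩
  · rw [← T.carrier_extendBy j, ← (T.extendBy j).carrier_extendBy m]
    refine PathFamily.carrier_mono fun w => ?_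
    by_cases hw : w ∈ α
    · rw [hSα ⟨w, hw⟩]
      exact hS' ⟨w, hw⟩
    · rw [hSn w hw]
      exact Finset.empty_subset _
  · rw [hμ.measure_carrier hl fun w c hc => by
      by_cases hw : w ∈ α
      · exact hfin hw c
      · rw [hSn w hw] at hc
        exact absurd hc (Finset.notMem_empty c), sum_card_mul_eq hSn]
    have hsum : ∑ w : α, ((S w).card : ℝ) * x w = lam ^ (m + j) * ∑ w, (k w : ℝ) * x w := by
      rw [← hμ.sum_mulVec_pow k (m + j)]
      refine Finset.sum_congr rfl fun w _ => ?_
      rw [hSα w, hS'card w]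
      congr 1
      exact_mod_cast congrArg (Int.cast : ℤ → ℝ) (Int.toNat_of_nonneg (hm2 w))
    rw [hsum, show n + j + m = m + j + n by omega, pow_add lam (m + j) n,
      mul_div_mul_left _ _ (pow_pos hl _).ne']

theorem subset_clopenValues [NullSingletonClass μ] (hμ : IsDefinedBy μ α lam x) (hB : B.Aperiodic)
    (herg : TailErgodic μ) (h0 : μ Set.univ = ⊤) {t : ℝ} (ht : t ∈ hμ.valueGroup) (ht0 : 0 ≤ t) :
    t ∈ clopenValues μ := by
  classical
  have : Fintype α := Fintype.ofFinite α
  have hl := hμ.lam_pos h0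
  rcases ht0.eq_or_lt with rfl | htpos
  · exact ⟨∅, isClopen_empty, by simp, by simp⟩
  obtain ⟨N, hN⟩ := ht
  obtain ⟨D, hD⟩ := hμ.exists_reduced_combination hl
  obtain ⟨M, hM⟩ := exists_forall_card_finPath_ge hB D
  -- `lam ^ n * t` must lie in `H` and exceed every combination with coefficients in `[0, D]`, and
  -- each vertex must have at least `D` finite paths.
  obtain ⟨n, hn, hnN, hnM⟩ := (((tendsto_pow_atTop_atTop_of_one_lt
    (hμ.one_lt_lam h0)).eventually_gt_atTop (((D : ℝ) * ∑ v, x v) / t)).and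
    ((Filter.eventually_ge_atTop N).and (Filter.eventually_ge_atTop M))).exists
  rw [div_lt_iff₀ htpos] at hn
  have hH : lam ^ n * t ∈ AddSubgroup.closure (Set.range x) := by
    obtain ⟨l, rfl⟩ := Nat.exists_eq_add_of_le' hnN
    rw [pow_add, mul_assoc]
    exact hμ.lam_mul_mem hN l
  obtain ⟨r, k, hrD, hr0, hrk⟩ := hD _ hH
  have hk : 0 < ∑ w, (k w : ℝ) * x w := by
    have : ∑ v, (r v : ℝ) * x v ≤ D * ∑ v, x v := by
      rw [Finset.mul_sum]
      exact Finset.sum_le_sum fun v _ =>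
        mul_le_mul_of_nonneg_right (Nat.cast_le.2 (hrD v)) (hμ.nonneg v)
    linarith
  have hex : ∀ w, ∃ S ⊆ (Finset.univ : Finset (B.FinPath n w)), S.card = r w := fun w =>
    Finset.exists_subset_card_eq ((hrD w).trans (hM n hnM w))
  choose S _ hScard using hex
  have hSfin : ∀ w, ∀ c ∈ S w, μ c.cyl < ⊤ := by
    intro w c hc
    by_cases hw : w ∈ outer μ α
    · exact measure_cyl_lt_top hw.1 c
    · have h := hScard w
      rw [hr0 w hw, Finset.card_eq_zero] at h
      rw [h] at hc
      exact absurd hc (Finset.notMem_empty c)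
  have hSμ := hμ.measure_carrier hl hSfin
  simp_rw [hScard] at hSμ
  -- The paths used outside `α` have finite total measure, so the positive part on `α` can be
  -- realized in the complement.
  have hTμ : μ (PathFamily.carrier fun w => (S w)ᶜ) = ⊤ := by
    rw [PathFamily.carrier_compl S]
    have h1 := measure_add_measure_compl (μ := μ) (PathFamily.isClopen_carrier S).2.measurableSet
    rw [h0, ENNReal.add_eq_top] at h1
    exact h1.resolve_left (by rw [hSμ]; exact ENNReal.ofReal_ne_top)
  obtain ⟨m, S₂, hsub, hS₂⟩ := hμ.exists_family_of_class_combination herg h0 hTμ hk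
  rw [PathFamily.carrier_compl S] at hsub
  have hU : μ (PathFamily.carrier S ∪ S₂.carrier) = ENNReal.ofReal t := by
    rw [measure_union (Set.disjoint_left.2 fun p hp hp2 => hsub hp2 hp)
      S₂.isClopen_carrier.2.measurableSet, hSμ, hS₂, ← ENNReal.ofReal_add
      (div_nonneg (Finset.sum_nonneg fun v _ => mul_nonneg (Nat.cast_nonneg _) (hμ.nonneg v))
        (pow_pos hl n).le) (div_pos hk (pow_pos hl n)).le, ← add_div, ← hrk,
      mul_div_cancel_left₀ _ (pow_pos hl n).ne']
  refine ⟨_, (PathFamily.isClopen_carrier S).union S₂.isClopen_carrier, ?_, ?_⟩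
  · rw [hU]
    exact ENNReal.ofReal_lt_top
  · rw [hU, ENNReal.toReal_ofReal htpos.le]

end IsDefinedBy

end StationaryBratteli

/-! ### Group-likeness and conclusion. -/

/-- The nonnegative part of a countable subgroup with arbitrarily small positive elements is
group-like. -/
theorem isGroupLike_of_addSubgroup {G : AddSubgroup ℝ} (hc : (G : Set ℝ).Countable)
    (hsmall : ∀ ε > 0, ∃ g ∈ G, g ∈ Set.Ioo 0 ε) : IsGroupLike ((G : Set ℝ) ∩ Set.Ici 0) := by
  have hdense : Dense (G : Set ℝ) := G.dense_of_not_isolated_zero hsmall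
  refine ⟨Set.inter_subset_right, ?_, hc.mono Set.inter_subset_left, ?_, fun γ _ => ⟨G, ?_⟩⟩
  · have h := closure_mono (hdense.open_subset_closure_inter (isOpen_Ioi (a := (0 : ℝ))))
    rw [closure_Ioi, closure_closure] at h
    exact h.trans (closure_mono fun g hg => ⟨hg.2, le_of_lt (Set.mem_Ioi.1 hg.1)⟩)
  · rintro ⟨b, hb⟩
    obtain ⟨g, hg, hg0, -⟩ := hsmall 1 one_pos
    obtain ⟨n, hn⟩ := exists_nat_gt (b / g)
    rw [div_lt_iff₀ hg0] at hn
    refine absurd (hb ⟨G.nsmul_mem hg n, ?_⟩) (not_le.2 ?_)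
    · exact nsmul_nonneg hg0.le n
    · rwa [nsmul_eq_mul]
  · ext t
    exact ⟨fun h => ⟨h.1.1, h.2⟩, fun h => ⟨⟨h.1, h.2.1⟩, h.2⟩⟩

theorem mainTheorem8 {V : Type*} [Fintype V] (B : StationaryBratteli V) (hB : B.Aperiodic)
    (μ : Measure B.PathSpace) [NullSingletonClass μ]
    (hinv : StationaryBratteli.TailInvariant μ) (herg : StationaryBratteli.TailErgodic μ)
    (hinf : μ Set.univ = ⊤)
    (α : Set V) (lam : ℝ) (x : V → ℝ) (hμ : StationaryBratteli.IsDefinedBy μ α lam x) :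
    IsGroupLike (clopenValues μ) ∧
      clopenValues μ =
        (⋃ N : ℕ, (fun h : ℝ => 1 / lam ^ N * h) '' (AddSubgroup.closure (Set.range x) : Set ℝ)) ∩
          Set.Ici 0 := by
  have hl := hμ.one_lt_lam hinf
  have hl0 : 0 < lam := one_pos.trans hl
  have heq : clopenValues μ = (hμ.valueGroup : Set ℝ) ∩ Set.Ici 0 :=
    (hμ.clopenValues_subset hl0).antisymm fun t ht =>
      hμ.subset_clopenValues hB herg hinf ht.1 ht.2
  rw [← hμ.coe_valueGroup hl0]
  refine ⟨?_, heq⟩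
  rw [heq]
  refine isGroupLike_of_addSubgroup ?_ fun ε hε => ?_
  · rw [hμ.coe_valueGroup hl0]
    refine Set.countable_iUnion fun N => Set.Countable.image ?_ _
    refine (Set.countable_range fun a : V → ℤ => ∑ v, a v • x v).mono fun h hh => ?_
    obtain ⟨a, rfl⟩ := AddSubgroup.mem_closure_range_iff_of_fintype.1 hh
    exact ⟨a, rfl⟩
  -- Since `lam > 1`, the elements `x v / lam ^ n` with `v ∈ α` are arbitrarily small.
  · obtain ⟨p, N, hN⟩ := hμ.exists_mem_eventuallyIn hinf
    have hx := hμ.pos _ (hμ.subset_finiteVertices (hN N le_rfl))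
    obtain ⟨n, hn⟩ := ((tendsto_pow_atTop_atTop_of_one_lt hl).eventually_gt_atTop
      (x (p.vertex N) / ε)).exists
    have hp := pow_pos hl0 n
    refine ⟨x (p.vertex N) / lam ^ n, ⟨n, ?_⟩, div_pos hx hp, ?_⟩
    · rw [mul_div_cancel₀ _ hp.ne']
      exact AddSubgroup.subset_closure (Set.mem_range_self _)
    · rwa [div_lt_iff₀ hp, mul_comm, ← div_lt_iff₀ hε]
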